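/- Let $c>0$ and $0<k<\alpha$. Let $\varphi:\mathbb R\to[0,\infty)$ be non-decreasing with $\varphi(x)\to0$ as $x\to-\infty$ and $\varphi(x)\to\infty$ as $x\to\infty$, and suppose that either $\varphi$ is strictly positive everywhere, or $\varphi$ vanishes below some level and is strictly increasing from that level on. Let $Z_1,Z_2,\dots$ be i.i.d. non-negative random variables with finite mean, whose common law satisfies condition (CZ): there are $0\le z_1<z_2<\infty$ and $h>0$ such that $\mathbf P(Z_1\in[u_1,u_2])\ge h\,(u_2-u_1)$ for every $[u_1,u_2]\subseteq[z_1,z_2]$. Consider the simple point process $N$ on $(0,\infty)$ with event times $0=t_0<t_1<t_2<\cdots$ and stochastic intensity $\lambda(t)=\varphi(X(t))+Y(t)$, where, with $N(t)=N((0,t])$, $$X(t)=X_0+ct-\sum_{n=1}^{N(t)}Z_n,\qquad Y(t)=Y_0e^{-\alpha t}+k\int_{(0,t]}e^{-\alpha(t-s)}\,dN(s),$$ $X_0$ is real, $Y_0\ge0$, and each $Z_n$ is independent of the past of the process up to and including the time $t_n$. That is, conditionally on $X_0,Y_0,t_1,\dots,t_n,Z_1,\dots,Z_n$, the waiting time $t_{n+1}-t_n$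 has hazard rate $s\mapsto\varphi(X(t_n)+cs)+Y(t_n)e^{-\alpha s}$. Put $X_n=X(t_n)$ and $Y_n=Y(t_n)$. Then $(X_n,Y_n)_{n\ge0}$ is a time-homogeneous Markov chain on $\mathbb R\times[0,\infty)$; from $(x,y)$ it moves to $(x+cT-Z,\;ye^{-\alpha T}+k)$, where $T$ and $Z$ are independent, $Z$ has the law of $Z_1$, and $$\mathbf P(T>t)=\exp\Big(-\int_0^t\big(\varphi(x+cv)+ye^{-\alpha v}\big)\,dv\Big),\qquad t\ge0.$$ This chain is Harris ergodic: it has a unique stationary probability distribution $\pi$, and for every initial state $w\in\mathbb R\times[0,\infty)$, $$\sup_{B}\big|\mathbf P\big((X_n,Y_n)\in B\mid (X_0,Y_0)=w\big)-\pi(B)\big|\longrightarrow0\qquad(n\to\infty),$$ the supremum being over the Borel sets $B\subseteq\mathbb R\times[0,\infty)$. -/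

import Mathlib

open MeasureTheory ProbabilityTheory Filter Topology
open scoped NNReal ENNReal

/-! ### Harris ergodicity of a general Markov chain -/

/-- Total variation distance `sup_B |μ(B) - ρ(B)|`, the supremum being over measurable sets. -/
noncomputable def tvDistance {W : Type*} [MeasurableSpace W] (μ ρ : Measure W) : ℝ :=
  ⨆ B : {B : Set W // MeasurableSet B}, |μ.real B.1 - ρ.real B.1|

/-- Harris ergodicity of the Markov chain with transition kernel `κ`: there is a unique stationary
probability distribution `π`, and from every initial state `w` the law `(κ ^ n) w` of the chain at
time `n` converges to `π` in total variation. -/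
def IsHarrisErgodic {W : Type*} [MeasurableSpace W] (κ : Kernel W W) : Prop :=
  ∃ π : Measure W,
    (IsProbabilityMeasure π ∧ κ.Invariant π) ∧
    (∀ ρ : Measure W, IsProbabilityMeasure ρ → κ.Invariant ρ → ρ = π) ∧
    ∀ w : W, Tendsto (fun n : ℕ => tvDistance ((κ ^ n) w) π) atTop (𝓝 0)

/-- `V 0, V 1, …` is a time-homogeneous Markov chain with transition kernel `κ`, with respect to
the increasing histories `ℋ 0, ℋ 1, …`. -/
structure IsMarkovChain {Ω W : Type*} [MeasurableSpace Ω] [MeasurableSpace W] (P : Measure Ω)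
    (ℋ : ℕ → MeasurableSpace Ω) (V : ℕ → Ω → W) (κ : Kernel W W) : Prop where
  adapted : ∀ n, Measurable[ℋ n] (V n)
  transition : ∀ (n : ℕ) (B : Set W), MeasurableSet B →
    P⟦V (n + 1) ⁻¹' B | ℋ n⟧ =ᵐ[P] fun ω => (κ (V n ω)).real B

/-! ### The ingredients of the model -/

/-- The standing assumptions on the primary rate function `φ`. -/
structure IsPrimaryRate (φ : ℝ → ℝ) : Prop where
  nonneg : ∀ x, 0 ≤ φ x
  monotone : Monotone φ
  tendsto_atBot : Tendsto φ atBot (𝓝 0)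
  tendsto_atTop : Tendsto φ atTop atTop
  pos_or_cutoff : (∀ x, 0 < φ x) ∨
    ∃ l : ℝ, (∀ x < l, φ x = 0) ∧ StrictMonoOn φ (Set.Ici l)

/-- Condition (CZ) on the law `ν` of a stress release `Z`. -/
def ConditionCZ (ν : Measure ℝ) : Prop :=
  ∃ z₁ z₂ h : ℝ, 0 ≤ z₁ ∧ z₁ < z₂ ∧ 0 < h ∧
    ∀ u₁ u₂ : ℝ, z₁ ≤ u₁ → u₁ ≤ u₂ → u₂ ≤ z₂ → h * (u₂ - u₁) ≤ ν.real (Set.Icc u₁ u₂)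

/-- If the last shock left the process in state `(x, y)`, this is the stochastic intensity after a
further time `s` without any shock. -/
noncomputable def hazard (c α : ℝ) (φ : ℝ → ℝ) (x y s : ℝ) : ℝ :=
  φ (x + c * s) + y * Real.exp (-α * s)

/-- `P(T > t)` for a waiting time `T` with hazard rate `hazard c α φ x y`. -/
noncomputable def survival (c α : ℝ) (φ : ℝ → ℝ) (x y t : ℝ) : ℝ :=
  Real.exp (-∫ s in (0 : ℝ)..t, hazard c α φ x y s)

/-- The law on `(0, ∞)` of a waiting time with hazard rate `hazard c α φ x y`: its density is the
hazard rate times the survival function. -/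
noncomputable def waitingLaw (c α : ℝ) (φ : ℝ → ℝ) (x y : ℝ) : Measure ℝ :=
  (volume.restrict (Set.Ioi 0)).withDensity
    (fun t => ENNReal.ofReal (hazard c α φ x y t * survival c α φ x y t))

/-! ### The transition kernel of the embedded chain -/

/-- The state after the next shock, if it occurs after a time `t` and releases the stress `z`. -/
noncomputable def nextState (c α k : ℝ) (w : ℝ × ℝ≥0) (t z : ℝ) : ℝ × ℝ≥0 :=
  (w.1 + c * t - z, (w.2 * Real.exp (-α * t) + k).toNNReal)

theorem measurable_hazard {c α : ℝ} {φ : ℝ → ℝ} (hφ : IsPrimaryRate φ) :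
    Measurable (fun p : (ℝ × ℝ≥0) × ℝ => hazard c α φ p.1.1 p.1.2 p.2) := by
  have := hφ.monotone.measurable
  unfold hazard
  fun_prop

theorem measurable_survival {c α : ℝ} {φ : ℝ → ℝ} (hφ : IsPrimaryRate φ) :
    Measurable (fun p : (ℝ × ℝ≥0) × ℝ => survival c α φ p.1.1 p.1.2 p.2) := by
  have hm : Measurable
      (fun q : ((ℝ × ℝ≥0) × ℝ) × ℝ => hazard c α φ q.1.1.1 q.1.1.2 q.2) :=
    (measurable_hazard (c := c) (α := α) hφ).comp
      ((measurable_fst.comp measurable_fst).prodMk measurable_snd)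
  have key : ∀ S : Set (((ℝ × ℝ≥0) × ℝ) × ℝ), MeasurableSet S →
      Measurable (fun p : (ℝ × ℝ≥0) × ℝ =>
        ∫ s in {s | (p, s) ∈ S}, hazard c α φ p.1.1 p.1.2 s) := by
    intro S hS
    have h1 := ((hm.indicator hS).stronglyMeasurable.integral_prod_right'
      (ν := (volume : Measure ℝ))).measurable
    refine Eq.mp (congrArg Measurable (funext fun p => ?_)) h1
    exact integral_indicator (s := {s | (p, s) ∈ S})
      (f := fun s => hazard c α φ p.1.1 p.1.2 s) (measurable_prodMk_left hS)
  have hA := key {q | q.2 ∈ Set.Ioc 0 q.1.2}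
    ((measurableSet_lt measurable_const measurable_snd).inter
      (measurableSet_le measurable_snd (measurable_snd.comp measurable_fst)))
  have hB := key {q | q.2 ∈ Set.Ioc q.1.2 0}
    ((measurableSet_lt (measurable_snd.comp measurable_fst) measurable_snd).inter
      (measurableSet_le measurable_snd measurable_const))
  exact Real.measurable_exp.comp (hA.sub hB).neg

theorem measurable_waitingLaw {c α : ℝ} {φ : ℝ → ℝ} (hφ : IsPrimaryRate φ) :
    Measurable (fun w : ℝ × ℝ≥0 => waitingLaw c α φ w.1 w.2) := by
  have hm : Measurable (Function.uncurry fun (w : ℝ × ℝ≥0) (t : ℝ) =>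
      ENNReal.ofReal (hazard c α φ w.1 w.2 t * survival c α φ w.1 w.2 t)) :=
    ((measurable_hazard hφ).mul (measurable_survival hφ)).ennreal_ofReal
  have h := (Kernel.withDensity (Kernel.const (ℝ × ℝ≥0)
    ((volume : Measure ℝ).restrict (Set.Ioi 0)))
    (fun w t => ENNReal.ofReal (hazard c α φ w.1 w.2 t * survival c α φ w.1 w.2 t))).measurable
  refine Eq.mp (congrArg Measurable (funext fun w => ?_)) h
  rw [Kernel.withDensity_apply _ hm, Kernel.const_apply, waitingLaw]

theorem measurable_nextState (c α k : ℝ) :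
    Measurable (fun q : (ℝ × ℝ≥0) × (ℝ × ℝ) => nextState c α k q.1 q.2.1 q.2.2) := by
  unfold nextState
  fun_prop

/-- The transition kernel of the embedded chain on `ℝ × [0, ∞)`: from `(x, y)`, draw independently
a waiting time `T` with hazard rate `φ (x + c s) + y exp (-α s)` and a stress release `Z` of
law `ν`, and move to `(x + c T - Z, y exp (-α T) + k)`. -/
noncomputable def embeddedKernel (c α k : ℝ) {φ : ℝ → ℝ} (hφ : IsPrimaryRate φ)
    (ν : Measure ℝ) [SFinite ν] : Kernel (ℝ × ℝ≥0) (ℝ × ℝ≥0) where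
  toFun w := ((waitingLaw c α φ w.1 w.2).prod ν).map (fun q => nextState c α k w q.1 q.2)
  measurable' := by
    have hd : Measurable (Function.uncurry fun (w : ℝ × ℝ≥0) (t : ℝ) =>
        ENNReal.ofReal (hazard c α φ w.1 w.2 t * survival c α φ w.1 w.2 t)) :=
      ((measurable_hazard hφ).mul (measurable_survival hφ)).ennreal_ofReal
    let κ := Kernel.withDensity (Kernel.const (ℝ × ℝ≥0)
      ((volume : Measure ℝ).restrict (Set.Ioi 0)))
      (fun w t => ENNReal.ofReal (hazard c α φ w.1 w.2 t * survival c α φ w.1 w.2 t))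
    have : IsSFiniteKernel κ := Kernel.IsSFiniteKernel.withDensity _
      (fun _ _ => ENNReal.ofReal_ne_top)
    have h := ((Kernel.id ×ₖ (κ ×ₖ Kernel.const (ℝ × ℝ≥0) ν)).map
      (fun q : (ℝ × ℝ≥0) × (ℝ × ℝ) => nextState c α k q.1 q.2.1 q.2.2)).measurable
    refine Eq.mp (congrArg Measurable (funext fun w => ?_)) h
    have hκ : κ w = waitingLaw c α φ w.1 w.2 := by
      simp only [κ, Kernel.withDensity_apply _ hd, Kernel.const_apply, waitingLaw]
    have : SFinite (waitingLaw c α φ w.1 w.2) := hκ ▸ inferInstance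
    rw [Kernel.map_apply _ (measurable_nextState c α k), Kernel.prod_apply, Kernel.prod_apply,
      Kernel.const_apply, Kernel.id_apply, hκ, Measure.dirac_prod,
      Measure.map_map (measurable_nextState c α k) measurable_prodMk_left]
    rfl

/-! ### The point process of shocks

`t 1 < t 2 < …` are the times of the shocks (and `t 0 = 0`), `Z i` is the stress released by the
shock at time `t i` (and `Z 0` is not used). -/

section PointProcess

variable {Ω : Type*}

/-- The number of shocks in `(0, s]`. -/
noncomputable def shockCount (t : ℕ → Ω → ℝ) (s : ℝ) (ω : Ω) : ℕ :=
  {i : ℕ | 1 ≤ i ∧ t i ω ≤ s}.ncard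

/-- `X(s) = X₀ + c s - ∑_{i = 1}^{N(s)} Z i`. -/
noncomputable def stress (c : ℝ) (X₀ : Ω → ℝ) (t Z : ℕ → Ω → ℝ) (s : ℝ) (ω : Ω) : ℝ :=
  X₀ ω + c * s - ∑ i ∈ Finset.Icc 1 (shockCount t s ω), Z i ω

/-- `Y(s) = Y₀ exp (-α s) + k ∫_{(0, s]} exp (-α (s - u)) dN(u)`, the integral being the sum over
the shocks up to time `s`. -/
noncomputable def aftershock (α k : ℝ) (Y₀ : Ω → ℝ) (t : ℕ → Ω → ℝ) (s : ℝ) (ω : Ω) : ℝ :=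
  Y₀ ω * Real.exp (-α * s) +
    k * ∑ i ∈ Finset.Icc 1 (shockCount t s ω), Real.exp (-α * (s - t i ω))

/-- The embedded sequence `(X(t n), Y(t n))`. -/
noncomputable def embedded (c α k : ℝ) (X₀ Y₀ : Ω → ℝ) (t Z : ℕ → Ω → ℝ) (n : ℕ) (ω : Ω) :
    ℝ × ℝ≥0 :=
  (stress c X₀ t Z (t n ω) ω, (aftershock α k Y₀ t (t n ω) ω).toNNReal)

/-- The history up to and including the `n`-th shock: the σ-algebra generated by the initial state
and by the times and stress releases of the first `n` shocks. -/
abbrev history (X₀ Y₀ : Ω → ℝ) (t Z : ℕ → Ω → ℝ) (n : ℕ) : MeasurableSpace Ω :=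
  (MeasurableSpace.comap X₀ inferInstance ⊔ MeasurableSpace.comap Y₀ inferInstance) ⊔
    ⨆ i ∈ Finset.Icc 1 n,
      (MeasurableSpace.comap (t i) inferInstance ⊔ MeasurableSpace.comap (Z i) inferInstance)

/-- The marked point process of shocks, with initial state `(X₀, Y₀)`: it is simple, its stochastic
intensity is `φ (X(s)) + Y(s)`, and the stress releases are i.i.d. with law `ν`.

The intensity is prescribed through the conditional hazard rates: given the history up to the
`n`-th shock, the hazard rate of the time from the `n`-th to the next shock is
`s ↦ φ (X(t n) + c s) + Y(t n) exp (-α s)`. Each stress release is independent of the past of the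
process up to and including the time of the shock. -/
structure IsShockProcess [MeasurableSpace Ω] (P : Measure Ω) (c α k : ℝ) (φ : ℝ → ℝ)
    (ν : Measure ℝ) (X₀ Y₀ : Ω → ℝ) (t Z : ℕ → Ω → ℝ) : Prop where
  measurable_X₀ : Measurable X₀
  measurable_Y₀ : Measurable Y₀
  Y₀_nonneg : ∀ ω, 0 ≤ Y₀ ω
  measurable_time : ∀ n, Measurable (t n)
  measurable_mark : ∀ n, Measurable (Z n)
  time_zero : ∀ ω, t 0 ω = 0
  strictMono_time : ∀ ω, StrictMono fun n => t n ω
  conditional_hazard : ∀ (n : ℕ) (s : ℝ), 0 ≤ s →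
    P⟦{ω | s < t (n + 1) ω - t n ω} | history X₀ Y₀ t Z n⟧ =ᵐ[P] fun ω =>
      survival c α φ (stress c X₀ t Z (t n ω) ω) (aftershock α k Y₀ t (t n ω) ω) s
  mark_law : ∀ n, P.map (Z (n + 1)) = ν
  mark_indep : ∀ n, Indep (MeasurableSpace.comap (Z (n + 1)) inferInstance)
    (history X₀ Y₀ t Z n ⊔ MeasurableSpace.comap (t (n + 1)) inferInstance) P

end PointProcess

/-!
# Harris ergodicity of the embedded chain of a stress release process with aftershocks

*Markov property.* At the times of the shocks both components are updated through
`nextState` (`embedded_succ`). Given the history, the waiting time has the prescribed hazard rate,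
hence the law `waitingLaw` (its tail is `survival`, see `waitingLaw_Ioi`), and the next stress
release is independent of it; so the joint law of state, waiting time and release, restricted to
any event of the history, is the composition-product of `IsShockProcess.map_transition`. This is
the transition kernel in disguise.

*Ergodicity.* The chain need not be geometrically ergodic: `φ` may decay slowly at `-∞`, and the
releases have only a finite mean. What holds is a drift condition without rate, together with a
minorization of the two-step kernel, and these suffice
(`isHarrisErgodic_of_drift_of_minorization`).

* Drift (`exists_lyapunov`). The Lyapunov function is `exp (b y) (1 + exp x) + x⁻`. Its first part
  contracts geometrically up to a constant. When `x` is large the waiting time is short, and the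
  loss of stress contributes the factor `E[exp (-Z)] < 1`. When `y` is large and `x` is bounded
  above, `y (1 - exp (-α T)) / α` is nearly an exponential variable of mean `1`, so that the factor
  is about `exp (b k) / (1 + b α)`, which is less than `1` for small `b` because `k < α`. The second
  part handles `x → -∞` with `y` bounded: there the waiting time exceeds any given `τ` with
  probability bounded below, so `x⁻` decreases on average by as much as desired.
* Minorization (`exists_le_comp_embeddedKernel`). For fixed releases, the state after two shocks is
  a diffeomorphic function of the two waiting times: `T₁ + T₂` determines the first coordinate, and
  then `T₂` the second one. If `T₁` is long, the memory of the initial `y` is negligible, and the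
  image covers a fixed rectangle for all initial states in a compact set.
* From drift and minorization to ergodicity. If `Q` is the two-step kernel and `f` is measurable
  with `n |f u - f v| ≤ V u + V v + L`, then `n |Q f x - Q f y| ≤ V x + V y + L - 1`: outside the
  small set the drift gains `1`, on it the coupling does, provided that `L` is large. Since moreover
  `|Q f x - Q f y| ≤ 1` for `0 ≤ f ≤ 1`, induction shows that the total variation distance of the
  laws of two copies of the chain after `2 n` steps is at most `(V x + V y + L) / n`. An invariant
  measure is obtained by summing the law of the chain killed at its regenerations.
-/

/-! ### Ergodicity from drift and minorization -/

section Harris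

variable {W : Type*} [MeasurableSpace W]

/-- Two measures of equal mass `m`, coupled independently: the difference of the integrals of `f`
is bounded through any bound of `f u - f v` that is a sum of a function of `u` and one of `v`. -/
theorem integral_sub_le_of_sub_le {μ ν : Measure W} [IsFiniteMeasure μ] [IsFiniteMeasure ν]
    {f V : W → ℝ} {m L : ℝ} (hm : 0 ≤ m) (hμ : μ.real Set.univ = m) (hν : ν.real Set.univ = m)
    (hfμ : Integrable f μ) (hfν : Integrable f ν) (hVμ : Integrable V μ) (hVν : Integrable V ν)
    (h : ∀ u v, f u - f v ≤ V u + V v + L) :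
    ∫ u, f u ∂μ - ∫ v, f v ∂ν ≤ ∫ u, V u ∂μ + ∫ v, V v ∂ν + m * L := by
  have h1 : ∀ u, m * f u - ∫ v, f v ∂ν ≤ m * V u + ∫ v, V v ∂ν + m * L := by
    intro u
    have := integral_mono (μ := ν) (f := fun v => f u - f v) (g := fun v => V u + V v + L)
      ((integrable_const _).sub hfν) (((integrable_const _).add hVν).add (integrable_const _))
      (fun v => h u v)
    have e : ∫ v, (V u + V v + L) ∂ν = m * V u + ∫ v, V v ∂ν + m * L := by
      rw [integral_add (by fun_prop) (by fun_prop), integral_add (by fun_prop) hVν]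
      simp [hν]
    rw [e, integral_sub (integrable_const _) hfν] at this
    simpa [hν] using this
  have h2 := integral_mono (μ := μ) (f := fun u => m * f u - ∫ v, f v ∂ν)
    (g := fun u => m * V u + ∫ v, V v ∂ν + m * L)
    ((hfμ.const_mul _).sub (integrable_const _))
    (((hVμ.const_mul _).add (integrable_const _)).add (integrable_const _)) h1
  rw [integral_sub (hfμ.const_mul _) (integrable_const _),
    integral_add (by fun_prop) (by fun_prop), integral_add (by fun_prop) (by fun_prop),
    integral_const_mul, integral_const_mul] at h2
  simp only [integral_const, hμ, smul_eq_mul] at h2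
  rcases hm.eq_or_lt with h0 | h0
  · subst h0
    have e1 : μ = 0 := by
      rw [← Measure.measure_univ_eq_zero]
      exact (measureReal_eq_zero_iff).1 hμ
    have e2 : ν = 0 := by
      rw [← Measure.measure_univ_eq_zero]
      exact (measureReal_eq_zero_iff).1 hν
    simp [e1, e2]
  · have : m * (∫ u, f u ∂μ - ∫ v, f v ∂ν) ≤
        m * (∫ u, V u ∂μ + ∫ v, V v ∂ν + m * L) := by linarith
    exact le_of_mul_le_mul_left this h0

/-- The kernel `Q` satisfies a Foster-Lyapunov drift condition towards the set `C`, with Lyapunov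
function `V`, and `C` is small for `Q`, with minorizing measure `ε • ρ`. The drift towards `C`
outweighs the possible growth `b`: then `V x + V y` has negative drift for two independent copies
as soon as one of them is outside `C`. -/
structure DriftMinorization (Q : Kernel W W) (V : W → ℝ) (b : ℝ) (C : Set W) (ε : ℝ≥0)
    (ρ : Measure W) : Prop where
  measurable : Measurable V
  nonneg : ∀ w, 0 ≤ V w
  bound_nonneg : 0 ≤ b
  measurableSet : MeasurableSet C
  integrable : ∀ w, Integrable V (Q w)
  growth : ∀ w, ∫ u, V u ∂Q w ≤ V w + b
  drift : ∀ w ∉ C, ∫ u, V u ∂Q w ≤ V w - (b + 1)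
  nonempty : C.Nonempty
  pos : 0 < ε
  minorization : ∀ w ∈ C, ε • ρ ≤ Q w

namespace DriftMinorization

variable {Q : Kernel W W} {V : W → ℝ} {b : ℝ} {C : Set W} {ε : ℝ≥0} {ρ : Measure W}

/-- The Lyapunov function is integrable for `ρ`, which is dominated by a multiple of some `Q w`. -/
theorem integrable_minorizing (h : DriftMinorization Q V b C ε ρ) : Integrable V ρ := by
  obtain ⟨w, hw⟩ := h.nonempty
  have h1 := (h.integrable w).mono_measure (h.minorization w hw)
  have h2 : (ε : ℝ≥0∞) • ρ = ε • ρ := rfl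
  rw [← h2] at h1
  exact (integrable_smul_measure (by simpa using h.pos.ne') (by simp)).1 h1

variable [IsProbabilityMeasure ρ]

/-- The residual kernel `Q - 1_C ⊗ ε ρ`: the moves of the chain that do not regenerate. -/
noncomputable def residual (h : DriftMinorization Q V b C ε ρ) : Kernel W W where
  toFun w := Q w - C.indicator (fun _ => ε • ρ) w
  measurable' := by
    classical
    refine Measure.measurable_of_measurable_coe _ fun s hs => ?_
    have e : (fun w => (Q w - C.indicator (fun _ => ε • ρ) w) s) =
        fun w => Q w s - C.indicator (fun _ => (ε • ρ) s) w := by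
      funext w
      by_cases hw : w ∈ C
      · simp only [Set.indicator_of_mem hw]
        rw [Measure.sub_apply hs (h.minorization w hw)]
      · simp [Set.indicator_of_notMem hw]
    rw [e]
    exact (Kernel.measurable_coe Q hs).sub (measurable_const.indicator h.measurableSet)

theorem residual_add (h : DriftMinorization Q V b C ε ρ) (w : W) :
    h.residual w + C.indicator (fun _ => ε • ρ) w = Q w := by
  change Q w - C.indicator (fun _ => ε • ρ) w + _ = _
  by_cases hw : w ∈ C
  · simp only [Set.indicator_of_mem hw]
    exact Measure.sub_add_cancel_of_le (h.minorization w hw)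
  · simp [Set.indicator_of_notMem hw]

variable [IsMarkovKernel Q]

/-- One step of two coupled copies of the chain lowers a bound of the form `V x + V y + L` by `1`,
provided that `L` is large compared with `1 / ε`. -/
theorem integral_sub_le (h : DriftMinorization Q V b C ε ρ) {L : ℝ}
    (hL : 2 * b + 1 ≤ ε * L) {f : W → ℝ} (hf : Measurable f)
    (hfb : ∃ M, ∀ u, |f u| ≤ M) (hfV : ∀ u v, f u - f v ≤ V u + V v + L) (x y : W) :
    ∫ u, f u ∂Q x - ∫ v, f v ∂Q y ≤ V x + V y + L - 1 := by
  obtain ⟨M, hM⟩ := hfb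
  have hi : ∀ μ : Measure W, IsFiniteMeasure μ → Integrable f μ := fun μ _ =>
    Integrable.of_bound hf.aestronglyMeasurable M (Eventually.of_forall hM)
  by_cases hx : x ∈ C
  · by_cases hy : y ∈ C
    · -- both copies regenerate with probability `ε`; otherwise they move by the residual measures
      have key : ∀ w ∈ C, ∃ S : Measure W, IsFiniteMeasure S ∧ S.real Set.univ = 1 - ε ∧
          S ≤ Q w ∧ ∀ g : W → ℝ, Integrable g (Q w) → 
          ∫ u, g u ∂Q w = ∫ u, g u ∂S + ε * ∫ u, g u ∂ρ := by
        intro w hw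
        have hle := h.minorization w hw
        have hadd := Measure.sub_add_cancel_of_le hle
        refine ⟨Q w - ε • ρ, inferInstance, ?_, Measure.sub_le, fun g hg => ?_⟩
        · have := congrArg (fun μ : Measure W => μ.real Set.univ) hadd
          change (Q w - ε • ρ + ε • ρ).real _ = (Q w).real _ at this
          rw [measureReal_add_apply, measureReal_nnreal_smul_apply,
            probReal_univ (μ := ρ), probReal_univ (μ := Q w)] at this
          linarith
        · have hg1 : Integrable g (Q w - ε • ρ) := hg.mono_measure Measure.sub_le
          have hg2 : Integrable g (ε • ρ) := hg.mono_measure hle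
          conv_lhs => rw [← hadd]
          rw [integral_add_measure hg1 hg2, integral_smul_nnreal_measure]
          simp [NNReal.smul_def]
      obtain ⟨S, hSf, hS1, hSle, hS⟩ := key x hx
      obtain ⟨S', hSf', hS1', hSle', hS'⟩ := key y hy
      rw [hS f (hi _ inferInstance), hS' f (hi _ inferInstance)]
      have h1 := integral_sub_le_of_sub_le (hS1 ▸ measureReal_nonneg) hS1 hS1' (hi S hSf)
        (hi S' hSf') ((h.integrable x).mono_measure hSle) ((h.integrable y).mono_measure hSle') hfV
      have h2 := hS V (h.integrable x)
      have h3 := hS' V (h.integrable y)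
      have h4 : 0 ≤ ∫ u, V u ∂ρ := integral_nonneg h.nonneg
      have h5 := mul_nonneg ε.coe_nonneg h4
      linarith [h.growth x, h.growth y]
    · have h1 := integral_sub_le_of_sub_le zero_le_one probReal_univ probReal_univ
        (hi (Q x) inferInstance) (hi (Q y) inferInstance) (h.integrable x) (h.integrable y) hfV
      linarith [h.growth x, h.drift y hy]
  · have h1 := integral_sub_le_of_sub_le zero_le_one probReal_univ probReal_univ
      (hi (Q x) inferInstance) (hi (Q y) inferInstance) (h.integrable x) (h.integrable y) hfV
    by_cases hy : y ∈ C
    · linarith [h.growth y, h.drift x hx]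
    · linarith [h.drift y hy, h.drift x hx, h.bound_nonneg]

/-- The killed chain has negative drift everywhere for `V + L`: in `C` this is due to the killing. -/
theorem lintegral_residual_add_one_le (h : DriftMinorization Q V b C ε ρ) {L : ℝ} (hL0 : 0 ≤ L)
    (hL : b + 1 ≤ ε * L) (w : W) :
    ∫⁻ u, ENNReal.ofReal (V u + L) ∂h.residual w + 1 ≤ ENNReal.ofReal (V w + L) := by
  have hle : h.residual w ≤ Q w := by
    conv_rhs => rw [← h.residual_add w]
    exact Measure.le_add_right le_rfl
  have : IsFiniteMeasure (h.residual w) := isFiniteMeasure_of_le _ hle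
  have hi := (h.integrable w).mono_measure hle
  rw [← ofReal_integral_eq_lintegral_ofReal (f := fun u => V u + L) (hi.add (integrable_const L))
    (Eventually.of_forall fun u => add_nonneg (h.nonneg u) hL0), ← ENNReal.ofReal_one,
    ← ENNReal.ofReal_add (integral_nonneg fun u => add_nonneg (h.nonneg u) hL0) zero_le_one]
  refine ENNReal.ofReal_le_ofReal ?_
  have e2 : ∫ u, V u ∂h.residual w ≤ ∫ u, V u ∂Q w :=
    integral_mono_measure hle (Eventually.of_forall h.nonneg) (h.integrable w)
  have e3 := congrArg (fun μ : Measure W => μ.real Set.univ) (h.residual_add w)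
  have e4 : ∫ u, (V u + L) ∂h.residual w
      = ∫ u, V u ∂h.residual w + (h.residual w).real Set.univ * L := by
    rw [integral_add hi (integrable_const _)]; simp
  rw [e4]
  by_cases hw : w ∈ C
  · simp only [Set.indicator_of_mem hw] at e3
    rw [measureReal_add_apply, measureReal_nnreal_smul_apply, probReal_univ (μ := ρ),
      probReal_univ (μ := Q w)] at e3
    have : (h.residual w).real Set.univ = 1 - ε := by linarith
    rw [this]
    linarith [h.growth w]
  · simp only [Set.indicator_of_notMem hw, add_zero, probReal_univ] at e3
    rw [e3]
    linarith [h.drift w hw, h.bound_nonneg]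

/-- The occupation measure of the chain started from `ρ` and killed at its first regeneration is
invariant. It is finite because of `lintegral_residual_add_one_le`. -/
theorem exists_invariant (h : DriftMinorization Q V b C ε ρ) :
    ∃ μ : Measure W, IsFiniteMeasure μ ∧ μ ≠ 0 ∧ μ.bind Q = μ := by
  let L : ℝ := (b + 1) / ε
  have hε : (0 : ℝ) < ε := h.pos
  have hL0 : 0 ≤ L := by have := h.bound_nonneg; positivity
  have hL : b + 1 ≤ ε * L := (mul_div_cancel₀ _ hε.ne').ge
  -- `m n` is the law at time `n` of the killed chain
  let m : ℕ → Measure W := fun n => Nat.rec ρ (fun _ μ => μ.bind h.residual) n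
  have m0 : m 0 = ρ := rfl
  have ms : ∀ n, m (n + 1) = (m n).bind h.residual := fun n => rfl
  have hmV : Measurable fun u => ENNReal.ofReal (V u + L) :=
    (h.measurable.add_const L).ennreal_ofReal
  have hsum : ∀ N, ∫⁻ u, ENNReal.ofReal (V u + L) ∂m N + ∑ n ∈ Finset.range N, m n Set.univ
      ≤ ∫⁻ u, ENNReal.ofReal (V u + L) ∂ρ := by
    intro N
    induction N with
    | zero => simp [m0]
    | succ N ih =>
      refine le_trans ?_ ih
      rw [Finset.sum_range_succ, ms, Measure.lintegral_bind h.residual.aemeasurable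
        hmV.aemeasurable, add_comm (∑ n ∈ Finset.range N, _), ← add_assoc]
      gcongr
      rw [← lintegral_one, ← lintegral_add_right _ measurable_const]
      exact lintegral_mono fun w => h.lintegral_residual_add_one_le hL0 hL w
  have hfin : ∫⁻ u, ENNReal.ofReal (V u + L) ∂ρ < ∞ :=
    (h.integrable_minorizing.add (integrable_const L)).lintegral_lt_top
  let μ := Measure.sum m
  have hμf : μ Set.univ < ∞ := by
    refine lt_of_le_of_lt ?_ hfin
    rw [Measure.sum_apply _ .univ]
    exact ENNReal.tsum_le_of_sum_range_le fun N => le_trans le_add_self (hsum N)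
  have hbind : ∀ s, MeasurableSet s → μ.bind Q s + ρ s = μ s + ε * μ C * ρ s := by
    intro s hs
    rw [Measure.bind_apply hs Q.aemeasurable]
    have e1 : ∀ w, Q w s = h.residual w s + C.indicator (fun _ => ε * ρ s) w := by
      intro w
      conv_lhs => rw [← h.residual_add w]
      by_cases hw : w ∈ C <;> simp [hw]
    simp_rw [e1]
    rw [lintegral_add_right _ (measurable_const.indicator h.measurableSet),
      lintegral_indicator h.measurableSet, setLIntegral_const]
    have e2 : ∫⁻ w, h.residual w s ∂μ + ρ s = μ s := by
      rw [lintegral_sum_measure, Measure.sum_apply _ hs,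
        tsum_eq_zero_add' (f := fun n => m n s) ENNReal.summable, m0, add_comm]
      congr 2
      funext n
      rw [ms, Measure.bind_apply hs h.residual.aemeasurable]
    rw [← e2]
    ring
  -- comparing total masses shows that the chain regenerates with total mass exactly one
  have huniv := hbind _ .univ
  have hQu : μ.bind Q Set.univ = μ Set.univ := by
    rw [Measure.bind_apply .univ Q.aemeasurable]; simp
  rw [hQu, measure_univ (μ := ρ), mul_one] at huniv
  have h1 : ε * μ C = 1 := ((ENNReal.add_right_inj hμf.ne).1 huniv).symm
  refine ⟨μ, ⟨hμf⟩, ?_, ?_⟩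
  · intro h0
    simp [h0] at h1
  · ext s hs
    have := hbind s hs
    rw [h1, one_mul] at this
    exact (ENNReal.add_left_inj (measure_ne_top _ _)).1 this

end DriftMinorization

instance isMarkovKernel_pow (κ : Kernel W W) [IsMarkovKernel κ] (n : ℕ) :
    IsMarkovKernel (κ ^ n) := by
  induction n with
  | zero => exact inferInstanceAs (IsMarkovKernel Kernel.id)
  | succ n ih => rw [pow_succ]; exact inferInstanceAs (IsMarkovKernel ((κ ^ n) ∘ₖ κ))

theorem measureReal_bind {μ : Measure W} (η : Kernel W W) [IsMarkovKernel η] {B : Set W}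
    (hB : MeasurableSet B) : (μ.bind η).real B = ∫ u, (η u).real B ∂μ := by
  rw [measureReal_def, Measure.bind_apply hB η.aemeasurable, ← integral_toReal
    (η.measurable_coe hB).aemeasurable (Eventually.of_forall fun u => measure_lt_top _ _)]
  rfl

theorem pow_add_apply_real (κ : Kernel W W) [IsMarkovKernel κ] (m n : ℕ) (x : W) {B : Set W}
    (hB : MeasurableSet B) :
    ((κ ^ (m + n)) x).real B = ∫ u, ((κ ^ m) u).real B ∂(κ ^ n) x := by
  rw [Kernel.pow_add, Kernel.comp_apply, measureReal_bind _ hB]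

theorem measurable_kernel_real (η : Kernel W W) {B : Set W} (hB : MeasurableSet B) :
    Measurable fun u => (η u).real B :=
  (η.measurable_coe hB).ennreal_toReal

theorem invariant_pow {κ : Kernel W W} {μ : Measure W} (h : κ.Invariant μ) (n : ℕ) :
    (κ ^ n).Invariant μ := by
  induction n with
  | zero => exact Measure.bind_dirac
  | succ n ih => rw [pow_succ]; exact ih.comp h

theorem tvDistance_le {μ ρ : Measure W} {δ : ℝ}
    (h : ∀ B, MeasurableSet B → |μ.real B - ρ.real B| ≤ δ) : tvDistance μ ρ ≤ δ :=
  have : Nonempty {B : Set W // MeasurableSet B} := ⟨⟨∅, .empty⟩⟩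
  ciSup_le fun B => h B.1 B.2

/-- If two copies of the chain couple at the rate `1 / n` with constants `V x + V y + L`, where `V`
need not be integrable for the invariant law, then the chain is Harris ergodic: truncate at `1` and
integrate over the invariant law. -/
theorem isHarrisErgodic_of_coupling {κ : Kernel W W} [IsMarkovKernel κ] {V : W → ℝ}
    (hV : Measurable V) (hV0 : ∀ w, 0 ≤ V w) {L : ℝ} (hL : 0 ≤ L)
    (hc : ∀ (n j : ℕ) (B : Set W), MeasurableSet B → ∀ x y,
      n * (((κ ^ (2 * n + j)) x).real B - ((κ ^ (2 * n + j)) y).real B) ≤ V x + V y + L)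
    (hπ : ∃ π : Measure W, IsProbabilityMeasure π ∧ κ.Invariant π) : IsHarrisErgodic κ := by
  have key : ∀ π : Measure W, IsProbabilityMeasure π → κ.Invariant π → ∀ w, ∃ δ : ℕ → ℝ,
      Tendsto δ atTop (𝓝 0) ∧ ∀ᶠ N in atTop, ∀ B, MeasurableSet B →
        |((κ ^ N) w).real B - π.real B| ≤ δ N := by
    intro π hπ1 hπ2 w
    -- for `N < 2` the quotient has the junk value `0`, so the estimate starts at `N = 2`
    let d : ℕ → W → ℝ := fun N z => min 1 ((V w + V z + L) / (N / 2 : ℕ))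
    have hd0 : ∀ N z, 0 ≤ d N z := fun N z =>
      le_min zero_le_one (div_nonneg (by linarith [hV0 w, hV0 z]) (Nat.cast_nonneg _))
    have hdm : ∀ N, AEStronglyMeasurable (d N) π := fun N =>
      Measurable.aestronglyMeasurable (by fun_prop)
    have hdb : ∀ N, ∀ᵐ z ∂π, ‖d N z‖ ≤ 1 := fun N => Eventually.of_forall fun z => by
      rw [Real.norm_of_nonneg (hd0 N z)]; exact min_le_left _ _
    have hhalf : Tendsto (fun N : ℕ => ((N / 2 : ℕ) : ℝ)) atTop atTop :=
      tendsto_natCast_atTop_atTop.comp (Nat.tendsto_div_const_atTop (by norm_num))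
    refine ⟨fun N => ∫ z, d N z ∂π, ?_, ?_⟩
    · have := tendsto_integral_of_dominated_convergence (μ := π) (F := d) (f := fun _ => 0)
        (fun _ => 1) hdm (integrable_const _) hdb (Eventually.of_forall fun z => ?_)
      · simpa using this
      · have h1 : Tendsto (fun N : ℕ => (V w + V z + L) / ((N / 2 : ℕ) : ℝ)) atTop (𝓝 0) :=
          tendsto_const_nhds.div_atTop hhalf
        simpa [d] using (tendsto_const_nhds (x := (1 : ℝ))).min h1
    · filter_upwards [eventually_ge_atTop 2] with N hN B hB
      have hN2 : (0 : ℝ) < (N / 2 : ℕ) := by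
        exact_mod_cast Nat.div_pos hN (by norm_num)
      have h1 : π.real B = ∫ z, ((κ ^ N) z).real B ∂π := by
        rw [← measureReal_bind _ hB, (invariant_pow hπ2 N).def]
      have hi : Integrable (fun z => ((κ ^ N) z).real B) π :=
        Integrable.of_bound (measurable_kernel_real _ hB).aestronglyMeasurable 1
          (Eventually.of_forall fun z => by
            rw [Real.norm_of_nonneg measureReal_nonneg]; exact measureReal_le_one)
      have h2 : ((κ ^ N) w).real B - π.real B
          = ∫ z, (((κ ^ N) w).real B - ((κ ^ N) z).real B) ∂π := by
        rw [integral_sub (integrable_const _) hi, ← h1]; simp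
      rw [h2]
      refine (norm_integral_le_integral_norm (μ := π) _).trans
        (integral_mono ((integrable_const _).sub hi).norm
          (Integrable.of_bound (hdm N) 1 (hdb N)) fun z => ?_)
      change |((κ ^ N) w).real B - ((κ ^ N) z).real B| ≤ d N z
      have hN' : 2 * (N / 2) + N % 2 = N := Nat.div_add_mod N 2
      have h3 := hc (N / 2) (N % 2) B hB w z
      have h4 := hc (N / 2) (N % 2) B hB z w
      rw [hN'] at h3 h4
      have h5 : ((κ ^ N) w).real B ≤ 1 := measureReal_le_one
      have h6 : ((κ ^ N) z).real B ≤ 1 := measureReal_le_one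
      have h7 : 0 ≤ ((κ ^ N) w).real B := measureReal_nonneg
      have h8 : 0 ≤ ((κ ^ N) z).real B := measureReal_nonneg
      refine le_min (abs_le.2 ⟨by linarith, by linarith⟩) ((le_div_iff₀ hN2).2 ?_)
      rw [← le_div_iff₀ hN2, abs_le, ← neg_div, div_le_iff₀ hN2, le_div_iff₀ hN2]
      constructor <;> linarith
  obtain ⟨π, hπ1, hπ2⟩ := hπ
  refine ⟨π, ⟨hπ1, hπ2⟩, fun ρ hρ1 hρ2 => ?_, fun w => ?_⟩
  · obtain ⟨w⟩ : Nonempty W := nonempty_of_isProbabilityMeasure π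
    obtain ⟨δ, hδ, hδ'⟩ := key π hπ1 hπ2 w
    obtain ⟨η, hη, hη'⟩ := key ρ hρ1 hρ2 w
    ext B hB
    rw [← measureReal_eq_measureReal_iff]
    have h0 : Tendsto (fun n => δ n + η n) atTop (𝓝 0) := by simpa using hδ.add hη
    have h1 : |ρ.real B - π.real B| ≤ 0 := by
      refine ge_of_tendsto h0 ?_
      filter_upwards [hδ', hη'] with N h1 h2
      have h1 := h1 B hB
      have h2 := h2 B hB
      rw [abs_le] at *
      constructor <;> linarith
    linarith [abs_nonpos_iff.1 h1]
  · obtain ⟨δ, hδ, hδ'⟩ := key π hπ1 hπ2 w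
    refine tendsto_of_tendsto_of_tendsto_of_le_of_le' tendsto_const_nhds hδ
      (Eventually.of_forall fun n => Real.iSup_nonneg fun B => abs_nonneg _) ?_
    filter_upwards [hδ'] with N hN using tvDistance_le hN

/-- Harris' theorem for a drift towards `C` that outweighs the growth of `V`, and a minorization of
the two-step kernel on `C`. -/
theorem isHarrisErgodic_of_drift_of_minorization {κ : Kernel W W} [IsMarkovKernel κ] {V : W → ℝ}
    (hV : Measurable V) (hV0 : ∀ w, 0 ≤ V w) {b : ℝ} (hb : 0 ≤ b) {C : Set W}
    (hC : MeasurableSet C) (hne : C.Nonempty) (hint : ∀ w, Integrable V (κ w))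
    (hgrowth : ∀ w, ∫ u, V u ∂κ w ≤ V w + b)
    (hdrift : ∀ w ∉ C, ∫ u, V u ∂κ w ≤ V w - (3 * b + 1))
    {ε : ℝ≥0} (hε : 0 < ε) {ρ : Measure W} [IsProbabilityMeasure ρ]
    (hminor : ∀ w ∈ C, ε • ρ ≤ (κ ∘ₖ κ) w) : IsHarrisErgodic κ := by
  have hκV : Measurable fun u => ∫ v, V v ∂κ u :=
    (hV.stronglyMeasurable.integral_kernel (κ := κ)).measurable
  have hint1 : ∀ w, Integrable (fun u => ∫ v, V v ∂κ u) (κ w) := fun w =>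
    ((hint w).add (integrable_const b)).mono' hκV.aestronglyMeasurable
      (Eventually.of_forall fun u => by
        rw [Real.norm_of_nonneg (integral_nonneg hV0)]; exact hgrowth u)
  have hint2 : ∀ w, Integrable V ((κ ∘ₖ κ) w) := fun w => by
    refine (integrable_comp_iff hV.aestronglyMeasurable).2
      ⟨Eventually.of_forall hint, ?_⟩
    simpa only [Real.norm_of_nonneg (hV0 _)] using hint1 w
  have hQ : ∀ w, ∫ u, V u ∂(κ ∘ₖ κ) w ≤ ∫ u, V u ∂κ w + b := fun w => by
    rw [Kernel.integral_comp (hint2 w)]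
    refine (integral_mono (hint1 w) ((hint w).add (integrable_const b)) hgrowth).trans ?_
    simp only [Pi.add_apply]
    rw [integral_add (hint w) (integrable_const b)]
    simp
  have hD : DriftMinorization (κ ∘ₖ κ) V (2 * b) C ε ρ :=
    ⟨hV, hV0, by linarith, hC, hint2, fun w => by linarith [hQ w, hgrowth w],
      fun w hw => by linarith [hQ w, hdrift w hw], hne, hε, hminor⟩
  have hε' : (0 : ℝ) < ε := hε
  have hL0 : 0 ≤ (2 * (2 * b) + 1) / ε := by positivity
  have hL : 2 * (2 * b) + 1 ≤ ε * ((2 * (2 * b) + 1) / ε) := (mul_div_cancel₀ _ hε'.ne').ge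
  refine isHarrisErgodic_of_coupling hV hV0 hL0 (fun n j B hB => ?_) ?_
  · induction n with
    | zero => intro x y; simp; linarith [hV0 x, hV0 y]
    | succ n ih =>
      intro x y
      have e : 2 * (n + 1) + j = (2 * n + j) + 2 := by ring
      have e2 : κ ^ 2 = κ ∘ₖ κ := pow_two κ
      have hb1 : ∀ u, ((κ ^ (2 * n + j)) u).real B ≤ 1 := fun u => measureReal_le_one
      have h1 := hD.integral_sub_le hL (f := fun u => n * ((κ ^ (2 * n + j)) u).real B)
        ((measurable_kernel_real _ hB).const_mul _) ⟨n, fun u => by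
          rw [abs_of_nonneg (mul_nonneg (Nat.cast_nonneg _) measureReal_nonneg)]
          exact mul_le_of_le_one_right (Nat.cast_nonneg _) (hb1 u)⟩
        (fun u v => by rw [← mul_sub]; exact ih u v) x y
      rw [integral_const_mul, integral_const_mul, ← e2, ← pow_add_apply_real _ _ _ _ hB,
        ← pow_add_apply_real _ _ _ _ hB, ← e] at h1
      have h2 : ((κ ^ (2 * (n + 1) + j)) x).real B ≤ 1 := measureReal_le_one
      have h3 : 0 ≤ ((κ ^ (2 * (n + 1) + j)) y).real B := measureReal_nonneg
      push_cast
      linarith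
  · -- if `μ` is invariant for the two-step kernel, then `μ + μ κ` is invariant for `κ`
    obtain ⟨μ, hμf, hμ0, hμ⟩ := hD.exists_invariant
    have hm : (μ + μ.bind κ) Set.univ ≠ 0 := by
      simpa using fun h => absurd h hμ0
    have hf : IsFiniteMeasure (μ.bind κ) := ⟨by
      rw [Measure.bind_apply .univ κ.aemeasurable]; simp [measure_lt_top]⟩
    have hinv : (μ + μ.bind κ).bind κ = μ + μ.bind κ := by
      rw [Measure.comp_add, Measure.comp_assoc, hμ, add_comm]
    refine ⟨((μ + μ.bind κ) Set.univ)⁻¹ • (μ + μ.bind κ), ⟨?_⟩, ?_⟩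
    · rw [Measure.smul_apply, smul_eq_mul, ENNReal.inv_mul_cancel hm (measure_ne_top _ _)]
    · rw [Kernel.Invariant, Measure.comp_smul, hinv]

end Harris

/-! ### The law of the waiting time -/

section WaitingTime

variable {c α : ℝ} {φ : ℝ → ℝ}

theorem hazard_nonneg (hφ : IsPrimaryRate φ) {y : ℝ} (hy : 0 ≤ y) (x s : ℝ) :
    0 ≤ hazard c α φ x y s :=
  add_nonneg (hφ.nonneg _) (mul_nonneg hy (Real.exp_pos _).le)

theorem monotone_rate_comp (hc : 0 ≤ c) (hφ : IsPrimaryRate φ) (x : ℝ) :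
    Monotone fun s => φ (x + c * s) := fun s t hst =>
  hφ.monotone (by gcongr)

theorem intervalIntegrable_exp_mul (y β a b : ℝ) :
    IntervalIntegrable (fun s => y * Real.exp (-β * s)) volume a b :=
  Continuous.intervalIntegrable (by fun_prop) a b

theorem intervalIntegrable_hazard (hc : 0 ≤ c) (hφ : IsPrimaryRate φ) (x y a b : ℝ) :
    IntervalIntegrable (hazard c α φ x y) volume a b :=
  ((monotone_rate_comp hc hφ x).intervalIntegrable).add (intervalIntegrable_exp_mul y α a b)

theorem survival_zero (x y : ℝ) : survival c α φ x y 0 = 1 := by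
  simp [survival]

theorem survival_nonneg (x y t : ℝ) : 0 ≤ survival c α φ x y t := (Real.exp_pos _).le

theorem continuous_survival (hc : 0 ≤ c) (hφ : IsPrimaryRate φ) (x y : ℝ) :
    Continuous (survival c α φ x y) :=
  Real.continuous_exp.comp (intervalIntegral.continuous_primitive
    (fun a b => intervalIntegrable_hazard hc hφ x y a b) 0).neg

theorem integral_hazard (hc : 0 ≤ c) (hα : α ≠ 0) (hφ : IsPrimaryRate φ) (x y a b : ℝ) :
    ∫ s in a..b, hazard c α φ x y s =
      (∫ s in a..b, φ (x + c * s)) + y * ((Real.exp (-α * a) - Real.exp (-α * b)) / α) := by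
  unfold hazard
  rw [intervalIntegral.integral_add (monotone_rate_comp hc hφ x).intervalIntegrable
    (intervalIntegrable_exp_mul y α a b), intervalIntegral.integral_const_mul]
  congr 2
  have hd : ∀ s ∈ Set.uIcc a b,
      HasDerivAt (fun s => -(Real.exp (-α * s) / α)) (Real.exp (-α * s)) s := by
    intro s _
    have h1 : HasDerivAt (fun s : ℝ => -α * s) (-α) s := by
      simpa using (hasDerivAt_id s).const_mul (-α)
    exact ((h1.exp.div_const α).neg).congr_deriv (by field_simp)
  rw [intervalIntegral.integral_eq_sub_of_hasDerivAt hd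
    (Continuous.intervalIntegrable (by fun_prop) a b)]
  ring

/-- Lower bound of the survival function up to time `τ`, from the monotonicity of `φ`. -/
theorem le_survival (hc : 0 ≤ c) (hα : α ≠ 0) (hφ : IsPrimaryRate φ) (x y : ℝ) {t τ : ℝ}
    (ht : 0 ≤ t) (htτ : t ≤ τ) :
    Real.exp (-(τ * φ (x + c * τ))) * Real.exp (-(y * ((1 - Real.exp (-α * t)) / α))) ≤
      survival c α φ x y t := by
  rw [survival, ← Real.exp_add, integral_hazard hc hα hφ]
  refine Real.exp_le_exp.2 ?_
  have h1 : ∫ s in (0 : ℝ)..t, φ (x + c * s) ≤ ∫ s in (0 : ℝ)..t, φ (x + c * τ) :=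
    intervalIntegral.integral_mono_on ht (monotone_rate_comp hc hφ x).intervalIntegrable
      intervalIntegrable_const fun s hs => hφ.monotone (by gcongr; exact hs.2.trans htτ)
  have h2 : t * φ (x + c * τ) ≤ τ * φ (x + c * τ) :=
    mul_le_mul_of_nonneg_right htτ (hφ.nonneg _)
  simp only [intervalIntegral.integral_const, sub_zero, smul_eq_mul] at h1
  simp only [mul_zero, Real.exp_zero]
  linarith

/-- Once the rate `φ` has reached `l`, the survival function decays at least at the rate `l`. -/
theorem survival_add_le (hc : 0 ≤ c) (hφ : IsPrimaryRate φ) {x y s₀ s l : ℝ} (hy : 0 ≤ y)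
    (hs₀ : 0 ≤ s₀) (hs : 0 ≤ s) (hl : l ≤ φ (x + c * s₀)) :
    survival c α φ x y (s₀ + s) ≤ Real.exp (-(l * s)) := by
  rw [survival]
  refine Real.exp_le_exp.2 (neg_le_neg ?_)
  have hi := fun a b => intervalIntegrable_hazard (α := α) hc hφ x y a b
  rw [← intervalIntegral.integral_add_adjacent_intervals (hi 0 s₀) (hi s₀ (s₀ + s))]
  have h1 : 0 ≤ ∫ s in (0 : ℝ)..s₀, hazard c α φ x y s :=
    intervalIntegral.integral_nonneg hs₀ fun _ _ => hazard_nonneg hφ hy _ _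
  have h2 : ∫ _ in s₀..(s₀ + s), l ≤ ∫ u in s₀..(s₀ + s), hazard c α φ x y u :=
    intervalIntegral.integral_mono_on (by linarith) intervalIntegrable_const (hi _ _)
      fun u hu => (hl.trans (monotone_rate_comp hc hφ x hu.1)).trans
        (le_add_of_nonneg_right (mul_nonneg hy (Real.exp_pos _).le))
  simp only [intervalIntegral.integral_const, add_sub_cancel_left, smul_eq_mul] at h2
  linarith

theorem exists_le_rate (hc : 0 < c) (hφ : IsPrimaryRate φ) (x l : ℝ) :
    ∃ s, 0 ≤ s ∧ l ≤ φ (x + c * s) := by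
  obtain ⟨x', hx'⟩ := (hφ.tendsto_atTop.eventually_ge_atTop l).exists
  refine ⟨max 0 ((x' - x) / c), le_max_left _ _, hx'.trans (hφ.monotone ?_)⟩
  have := (div_le_iff₀ hc).1 (le_max_right 0 ((x' - x) / c))
  linarith

theorem tendsto_survival (hc : 0 < c) (hφ : IsPrimaryRate φ) (x : ℝ) {y : ℝ} (hy : 0 ≤ y) :
    Tendsto (survival c α φ x y) atTop (𝓝 0) := by
  obtain ⟨s₀, hs₀, h⟩ := exists_le_rate hc hφ x 1
  have h1 : Tendsto (fun t : ℝ => Real.exp (-(1 * (t - s₀)))) atTop (𝓝 0) := by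
    refine Real.tendsto_exp_atBot.comp (tendsto_neg_atTop_atBot.comp ?_)
    simpa [sub_eq_add_neg] using tendsto_atTop_add_const_right _ (-s₀) tendsto_id
  refine tendsto_of_tendsto_of_tendsto_of_le_of_le' tendsto_const_nhds h1
    (Eventually.of_forall fun t => survival_nonneg _ _ _) ?_
  filter_upwards [eventually_ge_atTop s₀] with t ht
  simpa using survival_add_le (α := α) hc.le hφ hy hs₀ (sub_nonneg.2 ht) h

theorem intervalIntegrable_density (hc : 0 ≤ c) (hφ : IsPrimaryRate φ) (x y a b : ℝ) :
    IntervalIntegrable (fun t => hazard c α φ x y t * survival c α φ x y t) volume a b :=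
  (intervalIntegrable_hazard hc hφ x y a b).mul_continuousOn
    (continuous_survival hc hφ x y).continuousOn

/-- The fundamental theorem of calculus for `-survival`. As `φ` may jump, the derivative exists only
off the countable set of its discontinuities. -/
theorem integral_density (hc : 0 < c) (hφ : IsPrimaryRate φ) (x y : ℝ) {a b : ℝ} (hab : a ≤ b) :
    ∫ t in a..b, hazard c α φ x y t * survival c α φ x y t =
      survival c α φ x y a - survival c α φ x y b := by
  have hm := monotone_rate_comp hc.le hφ x
  have := integral_eq_of_hasDerivAt_off_countable_of_le
    (fun t => -survival c α φ x y t) (fun t => hazard c α φ x y t * survival c α φ x y t) hab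
    hm.countable_not_continuousAt (continuous_survival hc.le hφ x y).neg.continuousOn
    (fun t ht => ?_) (intervalIntegrable_density hc.le hφ x y a b)
  · rw [this]; ring
  · have ht' : ContinuousAt (hazard c α φ x y) t :=
      (not_not.1 ht.2).add (by fun_prop)
    have h1 := intervalIntegral.integral_hasDerivAt_right
      (intervalIntegrable_hazard (α := α) hc.le hφ x y 0 t)
      ((hm.measurable.add (by fun_prop : Measurable fun s => y * Real.exp (-α * s)))
        |>.stronglyMeasurable.stronglyMeasurableAtFilter) ht'
    exact h1.neg.exp.neg.congr_deriv (by simp only [survival, Pi.neg_apply]; ring)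

theorem waitingLaw_Ioc (hc : 0 < c) (hφ : IsPrimaryRate φ) (x : ℝ) {y a b : ℝ} (hy : 0 ≤ y)
    (ha : 0 ≤ a) (hab : a ≤ b) :
    waitingLaw c α φ x y (Set.Ioc a b) =
      ENNReal.ofReal (survival c α φ x y a - survival c α φ x y b) := by
  rw [waitingLaw, withDensity_apply _ measurableSet_Ioc, Measure.restrict_restrict
    measurableSet_Ioc, Set.inter_eq_left.2 (Set.Ioc_subset_Ioi_self.trans (Set.Ioi_subset_Ioi ha)),
    ← ofReal_integral_eq_lintegral_ofReal, ← intervalIntegral.integral_of_le hab,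
    integral_density hc hφ x y hab]
  · exact (intervalIntegrable_iff_integrableOn_Ioc_of_le hab).1
      (intervalIntegrable_density hc.le hφ x y a b)
  · exact Eventually.of_forall fun t =>
      mul_nonneg (hazard_nonneg hφ hy _ _) (survival_nonneg _ _ _)

/-- The waiting time has the tail `survival`, so the density that defines `waitingLaw` is the one
of a probability measure with the prescribed hazard rate. -/
theorem waitingLaw_Ioi (hc : 0 < c) (hφ : IsPrimaryRate φ) (x : ℝ) {y a : ℝ} (hy : 0 ≤ y)
    (ha : 0 ≤ a) :
    waitingLaw c α φ x y (Set.Ioi a) = ENNReal.ofReal (survival c α φ x y a) := by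
  have h1 : Tendsto (fun b => waitingLaw c α φ x y (Set.Ioc a b)) atTop
      (𝓝 (waitingLaw c α φ x y (Set.Ioi a))) := by
    rw [← Set.iUnion_Ioc_right]
    exact tendsto_measure_iUnion_atTop fun b b' h => Set.Ioc_subset_Ioc_right h
  have h2 : Tendsto (fun b => ENNReal.ofReal (survival c α φ x y a - survival c α φ x y b)) atTop
      (𝓝 (ENNReal.ofReal (survival c α φ x y a))) := by
    refine ENNReal.tendsto_ofReal ?_
    simpa using (tendsto_const_nhds (x := survival c α φ x y a)).sub (tendsto_survival hc hφ x hy)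
  refine tendsto_nhds_unique h1 (h2.congr' ?_)
  filter_upwards [eventually_ge_atTop a] with b hb
  rw [waitingLaw_Ioc hc hφ x hy ha hb]

theorem waitingLaw_Iic (x y : ℝ) : waitingLaw c α φ x y (Set.Iic 0) = 0 := by
  refine withDensity_absolutelyContinuous _ _ ?_
  rw [Measure.restrict_apply measurableSet_Iic]
  simp [Set.Iic_inter_Ioi]

theorem ae_waitingLaw_pos (x y : ℝ) : ∀ᵐ t ∂waitingLaw c α φ x y, 0 < t := by
  rw [ae_iff]
  simp only [not_lt]
  exact waitingLaw_Iic x y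

theorem isProbabilityMeasure_waitingLaw (hc : 0 < c) (hφ : IsPrimaryRate φ) (x : ℝ) {y : ℝ}
    (hy : 0 ≤ y) : IsProbabilityMeasure (waitingLaw c α φ x y) := by
  constructor
  rw [← Set.Iic_union_Ioi (a := (0 : ℝ)), measure_union (by simp) measurableSet_Ioi,
    waitingLaw_Iic, waitingLaw_Ioi hc hφ x hy le_rfl, survival_zero]
  simp

/-- If the rate `φ` is at least `l` from time `s₀` on, then `(T - s₀)⁺` is dominated by an exponential
variable of rate `l`, whence the bound on `E[exp (c T)]`. -/
theorem lintegral_exp_waitingLaw_le (hc : 0 < c) (hφ : IsPrimaryRate φ) {x y s₀ l : ℝ}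
    (hy : 0 ≤ y) (hs₀ : 0 ≤ s₀) (hl : l ≤ φ (x + c * s₀)) (hcl : c < l) :
    ∫⁻ t, ENNReal.ofReal (Real.exp (c * t)) ∂waitingLaw c α φ x y ≤
      ENNReal.ofReal (Real.exp (c * s₀) * (l / (l - c))) := by
  have := isProbabilityMeasure_waitingLaw (α := α) hc hφ x hy
  set μ := waitingLaw c α φ x y
  let f : ℝ → ℝ := fun t => max (t - s₀) 0
  have hfm : Measurable f := by fun_prop
  have hprim : ∀ r, ∫ s in (0 : ℝ)..r, c * Real.exp (c * s) = Real.exp (c * r) - 1 := by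
    intro r
    rw [intervalIntegral.integral_eq_sub_of_hasDerivAt (f := fun s => Real.exp (c * s))
      (fun s _ => ?_) (Continuous.intervalIntegrable (by fun_prop) _ _)]
    · simp
    · have h1 : HasDerivAt (fun s : ℝ => c * s) c s := by
        simpa using (hasDerivAt_id s).const_mul c
      exact h1.exp.congr_deriv (mul_comm _ _)
  have hlc := lintegral_comp_eq_lintegral_meas_lt_mul μ (f := f)
    (g := fun s => c * Real.exp (c * s)) (Eventually.of_forall fun t => le_max_right _ _)
    hfm.aemeasurable (fun t _ => Continuous.intervalIntegrable (by fun_prop) _ _)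
    (Eventually.of_forall fun t => by positivity)
  have hbd : ∫⁻ s in Set.Ioi 0, μ {a | s < f a} * ENNReal.ofReal (c * Real.exp (c * s)) ≤
      ENNReal.ofReal (c / (l - c)) := by
    have hneg : c - l < 0 := by linarith
    have e1 : ∫ s in Set.Ioi (0 : ℝ), c * Real.exp ((c - l) * s) = c / (l - c) := by
      rw [integral_const_mul, integral_exp_mul_Ioi hneg, mul_zero, Real.exp_zero, ← neg_sub c l,
        div_neg, neg_div, mul_neg, mul_one_div]
    rw [← e1, ofReal_integral_eq_lintegral_ofReal
      ((integrableOn_exp_mul_Ioi hneg 0).const_mul c)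
      (Eventually.of_forall fun s => by positivity)]
    refine setLIntegral_mono (by fun_prop) fun s hs => ?_
    have hs' : (0 : ℝ) < s := hs
    have e2 : {a | s < f a} = Set.Ioi (s₀ + s) := by
      ext t
      simp only [f, Set.mem_ofPred_eq, lt_max_iff, Set.mem_Ioi, not_lt.2 hs'.le, or_false]
      constructor <;> intro h <;> linarith
    rw [e2, waitingLaw_Ioi hc hφ x hy (by positivity),
      ← ENNReal.ofReal_mul (survival_nonneg _ _ _)]
    refine ENNReal.ofReal_le_ofReal ?_
    have e3 := survival_add_le (α := α) hc.le hφ hy hs₀ hs'.le hl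
    calc survival c α φ x y (s₀ + s) * (c * Real.exp (c * s))
        ≤ Real.exp (-(l * s)) * (c * Real.exp (c * s)) := by gcongr
      _ = c * (Real.exp (-(l * s)) * Real.exp (c * s)) := by ring
      _ = c * Real.exp ((c - l) * s) := by rw [← Real.exp_add]; ring_nf
  calc ∫⁻ t, ENNReal.ofReal (Real.exp (c * t)) ∂μ
      ≤ ∫⁻ t, ENNReal.ofReal (Real.exp (c * s₀)) *
          (ENNReal.ofReal (∫ s in (0 : ℝ)..f t, c * Real.exp (c * s)) + 1) ∂μ := by
        refine lintegral_mono fun t => ?_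
        have hf0 : 0 ≤ f t := le_max_right _ _
        have h0 : 1 ≤ Real.exp (c * f t) := Real.one_le_exp (by positivity)
        simp only [hprim]
        rw [← ENNReal.ofReal_one, ← ENNReal.ofReal_add (by linarith) zero_le_one,
          ← ENNReal.ofReal_mul (Real.exp_pos _).le, sub_add_cancel, ← Real.exp_add, ← mul_add]
        refine ENNReal.ofReal_le_ofReal (Real.exp_le_exp.2 ?_)
        have : t - s₀ ≤ f t := le_max_left _ _
        gcongr
        linarith
    _ = ENNReal.ofReal (Real.exp (c * s₀)) *
          ((∫⁻ s in Set.Ioi 0, μ {a | s < f a} * ENNReal.ofReal (c * Real.exp (c * s))) + 1) := by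
        rw [lintegral_const_mul' _ _ ENNReal.ofReal_ne_top, lintegral_add_right _ measurable_const,
          hlc]
        simp
    _ ≤ ENNReal.ofReal (Real.exp (c * s₀)) * (ENNReal.ofReal (c / (l - c)) + 1) := by gcongr
    _ = ENNReal.ofReal (Real.exp (c * s₀) * (l / (l - c))) := by
        rw [← ENNReal.ofReal_one, ← ENNReal.ofReal_add (div_nonneg hc.le (by linarith))
          zero_le_one, ← ENNReal.ofReal_mul (Real.exp_pos _).le]
        congr 2
        rw [div_add_one (by linarith)]
        congr 1
        ring

theorem integrable_exp_waitingLaw (hc : 0 < c) (hφ : IsPrimaryRate φ) (x : ℝ) {y : ℝ}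
    (hy : 0 ≤ y) : Integrable (fun t => Real.exp (c * t)) (waitingLaw c α φ x y) := by
  obtain ⟨s₀, hs₀, h⟩ := exists_le_rate hc hφ x (2 * c)
  refine ⟨by fun_prop, ?_⟩
  rw [hasFiniteIntegral_iff_ofReal (Eventually.of_forall fun t => (Real.exp_pos _).le)]
  exact (lintegral_exp_waitingLaw_le hc hφ hy hs₀ h (by linarith)).trans_lt ENNReal.ofReal_lt_top

/-- See `lintegral_exp_waitingLaw_le`. -/
theorem integral_exp_waitingLaw_le (hc : 0 < c) (hφ : IsPrimaryRate φ) {x y s₀ l : ℝ}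
    (hy : 0 ≤ y) (hs₀ : 0 ≤ s₀) (hl : l ≤ φ (x + c * s₀)) (hcl : c < l) :
    ∫ t, Real.exp (c * t) ∂waitingLaw c α φ x y ≤ Real.exp (c * s₀) * (l / (l - c)) := by
  have h0 : 0 ≤ Real.exp (c * s₀) * (l / (l - c)) :=
    mul_nonneg (Real.exp_pos _).le (div_nonneg (by linarith) (by linarith))
  rw [← ENNReal.ofReal_le_ofReal_iff h0, ofReal_integral_eq_lintegral_ofReal
    (integrable_exp_waitingLaw hc hφ x hy) (Eventually.of_forall fun t => (Real.exp_pos _).le)]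
  exact lintegral_exp_waitingLaw_le hc hφ hy hs₀ hl hcl

/-- If only the aftershock part of the hazard rate were present, then `y (1 - exp (-α T)) / α` would
be an exponential variable of mean `1`, truncated at `y / α`. The two corrections to the value
`1 / (1 + b α)` of its Laplace transform account for the rate `φ` and for the truncation. -/
theorem integral_discount_waitingLaw_le (hc : 0 < c) (hα : 0 < α) (hφ : IsPrimaryRate φ)
    (x : ℝ) {y b τ : ℝ} (hy : 0 ≤ y) (hb : 0 < b) (hτ : 0 ≤ τ) :
    ∫ t, Real.exp (-(b * y * (1 - Real.exp (-α * t)))) ∂waitingLaw c α φ x y ≤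
      1 - Real.exp (-(τ * φ (x + c * τ))) * (b * α / (1 + b * α)) *
        (1 - Real.exp (-((b + 1 / α) * y * (1 - Real.exp (-α * τ))))) := by
  have := isProbabilityMeasure_waitingLaw (α := α) hc hφ x hy
  set μ := waitingLaw c α φ x y
  have hprim : ∀ r β, ∫ s in (0 : ℝ)..r, β * y * α * Real.exp (-α * s) *
      Real.exp (-(β * y * (1 - Real.exp (-α * s)))) =
      1 - Real.exp (-(β * y * (1 - Real.exp (-α * r)))) := by
    intro r β
    rw [intervalIntegral.integral_eq_sub_of_hasDerivAt
      (f := fun s => -Real.exp (-(β * y * (1 - Real.exp (-α * s)))))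
      (fun s _ => ?_) (Continuous.intervalIntegrable (by fun_prop) _ _)]
    · simp; ring
    · have h1 : HasDerivAt (fun s : ℝ => -α * s) (-α) s := by
        simpa using (hasDerivAt_id s).const_mul (-α)
      exact ((((h1.exp.const_sub 1).const_mul (β * y)).neg).exp).neg.congr_deriv
        (by simp only [Pi.neg_apply]; ring)
  have hpos : ∀ᵐ t ∂μ, 0 < t := ae_waitingLaw_pos x y
  have hlc := lintegral_comp_eq_lintegral_meas_lt_mul μ (f := fun t => t)
    (g := fun s => b * y * α * Real.exp (-α * s) *
      Real.exp (-(b * y * (1 - Real.exp (-α * s))))) (hpos.mono fun t => le_of_lt)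
    measurable_id.aemeasurable (fun t _ => Continuous.intervalIntegrable (by fun_prop) _ _)
    (Eventually.of_forall fun t => by positivity)
  simp only [hprim] at hlc
  have hexp1 : ∀ t, 0 ≤ t → Real.exp (-α * t) ≤ 1 := fun t ht =>
    Real.exp_le_one_iff.2 (by nlinarith)
  have hu1 : ∀ t, 0 ≤ t → Real.exp (-(b * y * (1 - Real.exp (-α * t)))) ≤ 1 := fun t ht => by
    refine Real.exp_le_one_iff.2 (neg_nonpos.2 (mul_nonneg (by positivity) ?_))
    linarith [hexp1 t ht]
  have hui : Integrable (fun t => Real.exp (-(b * y * (1 - Real.exp (-α * t))))) μ :=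
    Integrable.of_bound (by fun_prop) 1 (hpos.mono fun t ht => by
      rw [Real.norm_of_nonneg (Real.exp_pos _).le]; exact hu1 t ht.le)
  have hi1 : 0 ≤ᵐ[μ] fun t => 1 - Real.exp (-(b * y * (1 - Real.exp (-α * t)))) :=
    hpos.mono fun t ht => sub_nonneg.2 (hu1 t ht.le)
  rw [← ofReal_integral_eq_lintegral_ofReal
    (f := fun t => 1 - Real.exp (-(b * y * (1 - Real.exp (-α * t)))))
    ((integrable_const 1).sub hui) hi1] at hlc
  have hlow : ENNReal.ofReal (Real.exp (-(τ * φ (x + c * τ))) * (b * α / (1 + b * α)) *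
        (1 - Real.exp (-((b + 1 / α) * y * (1 - Real.exp (-α * τ)))))) ≤
      ∫⁻ t in Set.Ioi 0, μ {a | t < a} * ENNReal.ofReal (b * y * α * Real.exp (-α * t) *
        Real.exp (-(b * y * (1 - Real.exp (-α * t))))) := by
    rw [← hprim, ← intervalIntegral.integral_const_mul, intervalIntegral.integral_of_le hτ,
      ofReal_integral_eq_lintegral_ofReal
        (Continuous.integrableOn_Ioc (by fun_prop))
        (Eventually.of_forall fun s => by positivity)]
    refine (setLIntegral_mono' measurableSet_Ioc fun t ht => ?_).trans
      (lintegral_mono_set Set.Ioc_subset_Ioi_self)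
    rw [show {a | t < a} = Set.Ioi t from rfl, waitingLaw_Ioi hc hφ x hy ht.1.le,
      ← ENNReal.ofReal_mul (survival_nonneg _ _ _)]
    refine ENNReal.ofReal_le_ofReal ?_
    refine le_trans (le_of_eq ?_) (mul_le_mul_of_nonneg_right
      (le_survival hc.le hα.ne' hφ x y ht.1.le ht.2) (by positivity))
    have e1 : Real.exp (-((b + 1 / α) * y * (1 - Real.exp (-α * t)))) =
        Real.exp (-(y * ((1 - Real.exp (-α * t)) / α))) *
          Real.exp (-(b * y * (1 - Real.exp (-α * t)))) := by
      rw [← Real.exp_add]; congr 1; field_simp; ring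
    rw [e1]
    have : 1 + b * α ≠ 0 := by positivity
    field_simp
    ring
  rw [← hlc, ENNReal.ofReal_le_ofReal_iff (integral_nonneg_of_ae hi1),
    integral_sub (integrable_const 1) hui] at hlow
  simp only [integral_const, probReal_univ, smul_eq_mul, mul_one] at hlow
  linarith

end WaitingTime

/-! ### The Lyapunov function -/

section Drift

variable {c α k : ℝ} {φ : ℝ → ℝ}

theorem measurable_nextState_apply (c α k : ℝ) (w : ℝ × ℝ≥0) :
    Measurable fun q : ℝ × ℝ => nextState c α k w q.1 q.2 :=
  (measurable_nextState c α k).comp measurable_prodMk_left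

theorem embeddedKernel_apply (hφ : IsPrimaryRate φ) (ν : Measure ℝ) [SFinite ν] (w : ℝ × ℝ≥0) :
    embeddedKernel c α k hφ ν w =
      ((waitingLaw c α φ w.1 w.2).prod ν).map (fun q => nextState c α k w q.1 q.2) := rfl

theorem isMarkovKernel_embeddedKernel (hc : 0 < c) (hφ : IsPrimaryRate φ) (ν : Measure ℝ)
    [IsProbabilityMeasure ν] : IsMarkovKernel (embeddedKernel c α k hφ ν) := by
  constructor
  intro w
  have := isProbabilityMeasure_waitingLaw (α := α) hc hφ w.1 w.2.coe_nonneg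
  rw [embeddedKernel_apply]
  exact Measure.isProbabilityMeasure_map (measurable_nextState_apply c α k w).aemeasurable

theorem coe_nextState_snd (hk : 0 ≤ k) (w : ℝ × ℝ≥0) (t z : ℝ) :
    ((nextState c α k w t z).2 : ℝ) = w.2 * Real.exp (-α * t) + k :=
  Real.coe_toNNReal _ (by positivity)

theorem nextState_fst (w : ℝ × ℝ≥0) (t z : ℝ) :
    (nextState c α k w t z).1 = w.1 + c * t - z := rfl

/-- The part `exp (b y) (1 + exp x)` of the Lyapunov function, which contracts geometrically up to a
constant. -/
noncomputable def expLyapunov (b : ℝ) (w : ℝ × ℝ≥0) : ℝ :=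
  Real.exp (b * w.2) * (1 + Real.exp w.1)

/-- After a shock, the factor `exp (b y)` is multiplied by `exp (b k)` and by the discount
`exp (-b y (1 - exp (-α t)))`. -/
theorem expLyapunov_nextState (hk : 0 ≤ k) (b : ℝ) (w : ℝ × ℝ≥0) (t z : ℝ) :
    expLyapunov b (nextState c α k w t z) =
      Real.exp (b * (w.2 + k)) * Real.exp (-(b * w.2 * (1 - Real.exp (-α * t)))) +
        Real.exp (b * (w.2 + k)) * Real.exp w.1 *
          (Real.exp (-(b * w.2 * (1 - Real.exp (-α * t)))) * Real.exp (c * t)) *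
            Real.exp (-z) := by
  rw [expLyapunov, coe_nextState_snd hk, nextState_fst]
  have e1 : b * (w.2 * Real.exp (-α * t) + k) =
      b * (w.2 + k) + -(b * w.2 * (1 - Real.exp (-α * t))) := by ring
  have e2 : w.1 + c * t - z = w.1 + c * t + -z := by ring
  rw [e1, e2, Real.exp_add, Real.exp_add, Real.exp_add]
  ring

section Discount

variable {x y b : ℝ}

theorem exp_discount_anti (hα : 0 ≤ α) (hy : 0 ≤ y) (hb : 0 ≤ b) {s t : ℝ}
    (hst : s ≤ t) : Real.exp (-(b * y * (1 - Real.exp (-α * t)))) ≤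
      Real.exp (-(b * y * (1 - Real.exp (-α * s)))) := by
  have : -α * t ≤ -α * s := by nlinarith
  gcongr

theorem integrable_discount (hc : 0 < c) (hα : 0 ≤ α) (hφ : IsPrimaryRate φ) (x : ℝ)
    (hy : 0 ≤ y) (hb : 0 ≤ b) :
    Integrable (fun t => Real.exp (-(b * y * (1 - Real.exp (-α * t)))))
      (waitingLaw c α φ x y) := by
  have := isProbabilityMeasure_waitingLaw (α := α) hc hφ x hy
  refine Integrable.of_bound (by fun_prop) 1 ((ae_waitingLaw_pos x y).mono fun t ht => ?_)
  rw [Real.norm_of_nonneg (Real.exp_pos _).le]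
  simpa using exp_discount_anti hα hy hb ht.le

theorem integrable_discount_mul_exp (hc : 0 < c) (hα : 0 ≤ α) (hφ : IsPrimaryRate φ) (x : ℝ)
    (hy : 0 ≤ y) (hb : 0 ≤ b) :
    Integrable (fun t => Real.exp (-(b * y * (1 - Real.exp (-α * t)))) * Real.exp (c * t))
      (waitingLaw c α φ x y) := by
  refine (integrable_exp_waitingLaw hc hφ x hy).mono' (by fun_prop)
    ((ae_waitingLaw_pos x y).mono fun t ht => ?_)
  rw [Real.norm_of_nonneg (by positivity)]
  refine mul_le_of_le_one_left (Real.exp_pos _).le ?_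
  simpa using exp_discount_anti hα hy hb ht.le

/-- A waiting time longer than `τ` comes with a small discount when `y` is large; then, for small `τ`,
the first term on the right, which is close to `1`, prevails. -/
theorem integral_discount_mul_exp_le (hc : 0 < c) (hα : 0 ≤ α) (hφ : IsPrimaryRate φ) (x : ℝ)
    (hy : 0 ≤ y) (hb : 0 ≤ b) (τ : ℝ) :
    ∫ t, Real.exp (-(b * y * (1 - Real.exp (-α * t)))) * Real.exp (c * t)
        ∂waitingLaw c α φ x y ≤
      Real.exp (c * τ) + Real.exp (-(b * y * (1 - Real.exp (-α * τ)))) *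
        ∫ t, Real.exp (c * t) ∂waitingLaw c α φ x y := by
  have := isProbabilityMeasure_waitingLaw (α := α) hc hφ x hy
  have hi := (integrable_exp_waitingLaw (α := α) hc hφ x hy).const_mul
    (Real.exp (-(b * y * (1 - Real.exp (-α * τ)))))
  have h1 := integral_mono_ae (integrable_discount_mul_exp hc hα hφ x hy hb)
    ((integrable_const (Real.exp (c * τ))).add hi) ((ae_waitingLaw_pos x y).mono fun t ht => ?_)
  · refine h1.trans_eq ?_
    simp only [Pi.add_apply]
    rw [integral_add (integrable_const _) hi, integral_const_mul]
    simp
  · simp only [Pi.add_apply]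
    have hp := Real.exp_pos (c * t)
    rcases le_total t τ with h | h
    · refine (mul_le_of_le_one_left hp.le ?_).trans
        ((Real.exp_le_exp.2 (by gcongr)).trans (le_add_of_nonneg_right (by positivity)))
      simpa using exp_discount_anti hα hy hb ht.le
    · refine (mul_le_mul_of_nonneg_right (exp_discount_anti hα hy hb h) hp.le).trans
        (le_add_of_nonneg_left (Real.exp_pos _).le)

end Discount

section Kernel

variable (ν : Measure ℝ) [IsProbabilityMeasure ν]

theorem integrable_exp_neg (hν : ∀ᵐ z ∂ν, 0 ≤ z) : Integrable (fun z => Real.exp (-z)) ν :=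
  Integrable.of_bound (by fun_prop) 1 (hν.mono fun z hz => by
    rw [Real.norm_of_nonneg (Real.exp_pos _).le]
    exact Real.exp_le_one_iff.2 (neg_nonpos.2 hz))

/-- Condition (CZ) excludes that the stress releases vanish almost surely. -/
theorem integral_exp_neg_lt_one (hν : ∀ᵐ z ∂ν, 0 ≤ z) (hCZ : ConditionCZ ν) :
    ∫ z, Real.exp (-z) ∂ν < 1 := by
  by_contra! hge
  have hi := integrable_exp_neg ν hν
  have h0 : 0 ≤ᵐ[ν] fun z => 1 - Real.exp (-z) := hν.mono fun z hz =>
    sub_nonneg.2 (Real.exp_le_one_iff.2 (neg_nonpos.2 hz))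
  have h1 : ∫ z, (1 - Real.exp (-z)) ∂ν = 0 := by
    refine le_antisymm ?_ (integral_nonneg_of_ae h0)
    rw [integral_sub (integrable_const _) hi]
    simpa using hge
  have h2 := (integral_eq_zero_iff_of_nonneg_ae h0 ((integrable_const _).sub hi)).1 h1
  obtain ⟨z₁, z₂, h, hz1, hz12, hh, H⟩ := hCZ
  have h3 := H ((z₁ + z₂) / 2) z₂ (by linarith) (by linarith) le_rfl
  have h4 : ν (Set.Icc ((z₁ + z₂) / 2) z₂) = 0 := by
    refine measure_mono_null (fun z hz => ?_) (ae_iff.1 h2)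
    have hz' : 0 < z := by linarith [hz.1]
    have : Real.exp (-z) < 1 := by simpa using Real.exp_lt_exp.2 (show -z < 0 by linarith)
    simp only [Set.mem_ofPred_eq, Pi.zero_apply]
    linarith
  rw [measureReal_def, h4, ENNReal.toReal_zero] at h3
  nlinarith

theorem integrable_expLyapunov_and_integral_eq (hc : 0 < c) (hα : 0 ≤ α) (hk : 0 ≤ k)
    (hφ : IsPrimaryRate φ) (hν : ∀ᵐ z ∂ν, 0 ≤ z) {b : ℝ} (hb : 0 ≤ b) (w : ℝ × ℝ≥0) :
    Integrable (expLyapunov b) (embeddedKernel c α k hφ ν w) ∧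
    ∫ u, expLyapunov b u ∂embeddedKernel c α k hφ ν w =
      Real.exp (b * (w.2 + k)) *
        (∫ t, Real.exp (-(b * w.2 * (1 - Real.exp (-α * t)))) ∂waitingLaw c α φ w.1 w.2 +
        (∫ z, Real.exp (-z) ∂ν) * Real.exp w.1 *
          ∫ t, Real.exp (-(b * w.2 * (1 - Real.exp (-α * t)))) * Real.exp (c * t)
            ∂waitingLaw c α φ w.1 w.2) := by
  have hy : (0 : ℝ) ≤ w.2 := w.2.coe_nonneg
  have := isProbabilityMeasure_waitingLaw (α := α) hc hφ w.1 hy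
  have hm := (measurable_nextState_apply c α k w).aemeasurable
    (μ := (waitingLaw c α φ w.1 w.2).prod ν)
  have hV : Measurable (expLyapunov b) := by unfold expLyapunov; fun_prop
  have i1 := ((integrable_discount hc hα hφ w.1 hy hb).const_mul
    (Real.exp (b * (w.2 + k)))).comp_fst ν
  have i2 := ((integrable_discount_mul_exp hc hα hφ w.1 hy hb).const_mul
    (Real.exp (b * (w.2 + k)) * Real.exp w.1)).mul_prod (integrable_exp_neg ν hν)
  rw [embeddedKernel_apply, integral_map hm hV.aestronglyMeasurable,
    integrable_map_measure hV.aestronglyMeasurable hm]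
  simp only [Function.comp_def, expLyapunov_nextState hk]
  refine ⟨i1.add i2, ?_⟩
  rw [integral_add i1 i2, integral_prod_mul (fun t => Real.exp (b * (w.2 + k)) * Real.exp w.1 *
    (Real.exp (-(b * w.2 * (1 - Real.exp (-α * t)))) * Real.exp (c * t))) (fun z => Real.exp (-z))]
  have e := integral_fun_fst (μ := waitingLaw c α φ w.1 w.2) (ν := ν)
    (fun t => Real.exp (b * (w.2 + k)) * Real.exp (-(b * w.2 * (1 - Real.exp (-α * t)))))
  rw [e, integral_const_mul, integral_const_mul, probReal_univ, one_smul]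
  ring

/-- As `b → 0`, `exp (b k) = 1 + b k + o(b)` is less than `1 + b α`, because `k < α`. -/
theorem exists_discount_rate (hk : 0 < k) (hkα : k < α) {q : ℝ} (hq : q < 1) :
    ∃ b, 0 < b ∧ Real.exp (b * k) * q < 1 ∧ Real.exp (b * k) < 1 + b * α := by
  have hα : 0 < α := hk.trans hkα
  have h1 : Tendsto (fun b : ℝ => Real.exp (b * k) * q) (𝓝[>] 0) (𝓝 q) := by
    have : Continuous fun b : ℝ => Real.exp (b * k) * q := by fun_prop
    simpa using (this.tendsto 0).mono_left nhdsWithin_le_nhds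
  have h2 : (0 : ℝ) < (α - k) / (k * α) := div_pos (by linarith) (by positivity)
  obtain ⟨b, hb1, hb2⟩ := ((h1.eventually_lt_const hq).and (Ioo_mem_nhdsGT h2)).exists
  refine ⟨b, hb2.1, hb1, ?_⟩
  have h3 := (lt_div_iff₀ (by positivity)).1 hb2.2
  have h4 : 1 - b * k ≤ Real.exp (-(b * k)) := by
    have := Real.add_one_le_exp (-(b * k)); linarith
  have h5 : Real.exp (b * k) * (1 - b * k) ≤ 1 := by
    calc Real.exp (b * k) * (1 - b * k) ≤ Real.exp (b * k) * Real.exp (-(b * k)) := by gcongr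
      _ = 1 := by rw [← Real.exp_add]; simp
  have h6 : 1 < (1 + b * α) * (1 - b * k) := by nlinarith [hb2.1]
  have h7 : 0 < 1 - b * k := by
    have := hb2.1
    by_contra! h
    have : (1 + b * α) * (1 - b * k) ≤ 0 := mul_nonpos_of_nonneg_of_nonpos (by positivity) h
    linarith
  exact lt_of_mul_lt_mul_right (h5.trans_lt h6) h7.le

/-- The geometric drift of `expLyapunov`. The contraction holds for large `x`, and for large `y` when
`x` is bounded above; elsewhere the integral is bounded. -/
theorem expLyapunov_drift (hc : 0 < c) (hα : 0 < α) (hk : 0 < k)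
    (hφ : IsPrimaryRate φ) (hν : ∀ᵐ z ∂ν, 0 ≤ z) {b : ℝ} (hb : 0 < b)
    (hbq : Real.exp (b * k) * ∫ z, Real.exp (-z) ∂ν < 1) (hbα : Real.exp (b * k) < 1 + b * α) :
    ∃ γ K : ℝ, γ < 1 ∧ 0 ≤ K ∧ ∀ w : ℝ × ℝ≥0,
      ∫ u, expLyapunov b u ∂embeddedKernel c α k hφ ν w ≤ γ * expLyapunov b w + K := by
  set q := ∫ z, Real.exp (-z) ∂ν with hq
  have hq0 : 0 ≤ q := integral_nonneg fun z => (Real.exp_pos _).le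
  set E := Real.exp (b * k) with hE
  have hE0 : 0 < E := Real.exp_pos _
  have hbα0 : 0 < 1 + b * α := by positivity
  have hθ : E / (1 + b * α) < 1 := (div_lt_one hbα0).2 hbα
  obtain ⟨γ, hγm, hγ1⟩ := exists_between (max_lt hbq hθ)
  have hγq : E * q < γ := (le_max_left _ _).trans_lt hγm
  have hγθ : E / (1 + b * α) < γ := (le_max_right _ _).trans_lt hγm
  have hγ0 : 0 < γ := (mul_nonneg hE0.le hq0).trans_lt hγq
  -- the region of large `x`
  -- there the waiting time is short, and `exp (-Z)` gives the contraction
  obtain ⟨γ', hγ'q, hγ'⟩ := exists_between hγq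
  have hlarge : ∃ x₁, ∀ x, x₁ ≤ x → ∀ y, 0 ≤ y →
      E * (1 + q * Real.exp x * ∫ t, Real.exp (c * t) ∂waitingLaw c α φ x y) ≤
        γ * (1 + Real.exp x) := by
    have h1 : Tendsto (fun l : ℝ => E * q * (1 + c / (l - c))) atTop (𝓝 (E * q * (1 + 0))) :=
      (((tendsto_const_nhds (x := c)).div_atTop
        (tendsto_atTop_add_const_right _ (-c) tendsto_id)).const_add 1).const_mul _
    rw [add_zero, mul_one] at h1
    obtain ⟨l, hl1, hl2⟩ := ((h1.eventually_lt_const hγ'q).and (eventually_gt_atTop c)).exists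
    have h2 := hφ.tendsto_atTop.eventually_ge_atTop l
    have h3 := Real.tendsto_exp_atTop.eventually_ge_atTop (E / (γ - γ'))
    obtain ⟨x₁, hx₁⟩ := eventually_atTop.1 (h2.and h3)
    refine ⟨x₁, fun x hx y hy => ?_⟩
    obtain ⟨hx2, hx3⟩ := hx₁ x hx
    have h4 := integral_exp_waitingLaw_le (α := α) (x := x) (s₀ := 0) hc hφ hy le_rfl
      (by simpa using hx2) hl2
    have h5 : l / (l - c) = 1 + c / (l - c) := by
      have : l - c ≠ 0 := (sub_pos.2 hl2).ne'
      field_simp; ring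
    rw [mul_zero, Real.exp_zero, one_mul, h5] at h4
    have h6 : E ≤ (γ - γ') * Real.exp x := by
      rw [mul_comm]; exact (div_le_iff₀ (sub_pos.2 hγ')).1 hx3
    calc E * (1 + q * Real.exp x * ∫ t, Real.exp (c * t) ∂waitingLaw c α φ x y)
        ≤ E * (1 + q * Real.exp x * (1 + c / (l - c))) := by gcongr
      _ = E + (E * q * (1 + c / (l - c))) * Real.exp x := by ring
      _ ≤ (γ - γ') * Real.exp x + γ' * Real.exp x := by gcongr
      _ ≤ γ * (1 + Real.exp x) := by linarith
  obtain ⟨x₁, hx₁⟩ := hlarge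
  -- exponential moments of the overshoot when `x` is bounded above
  obtain ⟨K₁, hK₁0, hK₁⟩ : ∃ K₁ : ℝ, 0 ≤ K₁ ∧ ∀ x, x ≤ x₁ → ∀ y, 0 ≤ y →
      Real.exp x * ∫ t, Real.exp (c * t) ∂waitingLaw c α φ x y ≤ K₁ := by
    obtain ⟨x', hx', hx'1⟩ := ((hφ.tendsto_atTop.eventually_ge_atTop (2 * c)).and
      (eventually_ge_atTop x₁)).exists
    refine ⟨Real.exp x' * 2, by positivity, fun x hx y hy => ?_⟩
    have e1 : x + c * ((x' - x) / c) = x' := by field_simp; ring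
    have h4 := integral_exp_waitingLaw_le (α := α) (x := x) (s₀ := (x' - x) / c) hc hφ hy
      (div_nonneg (by linarith) hc.le) (by rwa [e1]) (by linarith : c < 2 * c)
    refine (mul_le_mul_of_nonneg_left h4 (Real.exp_pos _).le).trans_eq ?_
    rw [← mul_assoc, ← Real.exp_add, e1]
    congr 1
    field_simp
    norm_num
  -- the region of bounded `x` and large `y`
  obtain ⟨y₁, hy₁0, hy₁⟩ : ∃ y₁ : ℝ, 0 ≤ y₁ ∧ ∀ x, x ≤ x₁ → ∀ y, y₁ ≤ y →
      E * (∫ t, Real.exp (-(b * y * (1 - Real.exp (-α * t)))) ∂waitingLaw c α φ x y +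
        q * Real.exp x * ∫ t, Real.exp (-(b * y * (1 - Real.exp (-α * t)))) * Real.exp (c * t)
          ∂waitingLaw c α φ x y) ≤ γ * (1 + Real.exp x) := by
    -- as `τ → 0` and then `y → ∞`, the discount is at most about `1 / (1 + b α)`
    set Φ := φ (x₁ + c)
    have hτ : ∃ τ, 0 < τ ∧ τ ≤ 1 ∧ E * q * Real.exp (c * τ) < γ ∧
        E * (1 - Real.exp (-(τ * Φ)) * (b * α / (1 + b * α))) < γ := by
      have h1 : Tendsto (fun τ : ℝ => E * q * Real.exp (c * τ)) (𝓝[>] 0) (𝓝 (E * q)) := by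
        have : Continuous fun τ : ℝ => E * q * Real.exp (c * τ) := by fun_prop
        simpa using (this.tendsto 0).mono_left nhdsWithin_le_nhds
      have h2 : Tendsto (fun τ : ℝ => E * (1 - Real.exp (-(τ * Φ)) * (b * α / (1 + b * α))))
          (𝓝[>] 0) (𝓝 (E / (1 + b * α))) := by
        have : Continuous fun τ : ℝ => E * (1 - Real.exp (-(τ * Φ)) * (b * α / (1 + b * α))) := by
          fun_prop
        have h := (this.tendsto 0).mono_left (nhdsWithin_le_nhds (s := Set.Ioi 0))
        have e : E / (1 + b * α) =
            E * (1 - Real.exp (-(0 * Φ)) * (b * α / (1 + b * α))) := by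
          rw [zero_mul, neg_zero, Real.exp_zero]; field_simp; ring
        rwa [e]
      obtain ⟨τ, ⟨h3, h4⟩, h5⟩ := ((h1.eventually_lt_const hγq).and
        (h2.eventually_lt_const hγθ)).and (Ioc_mem_nhdsGT (zero_lt_one (α := ℝ))) |>.exists
      exact ⟨τ, h5.1, h5.2, h3, h4⟩
    obtain ⟨τ, hτ0, hτ1, hτ2, hτ3⟩ := hτ
    set d := 1 - Real.exp (-α * τ)
    have hd : 0 < d := sub_pos.2 (by
      simpa using Real.exp_lt_exp.2 (show -α * τ < 0 by nlinarith))
    set A := Real.exp (-(τ * Φ)) * (b * α / (1 + b * α))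
    have hdec : ∀ β : ℝ, 0 < β → Tendsto (fun y : ℝ => Real.exp (-(β * y * d))) atTop (𝓝 0) := by
      intro β hβ
      refine Real.tendsto_exp_atBot.comp (tendsto_neg_atTop_atBot.comp ?_)
      exact (tendsto_id.const_mul_atTop hβ).atTop_mul_const hd
    have hlim : Tendsto (fun y : ℝ => E * (1 - A * (1 - Real.exp (-((b + 1 / α) * y * d)))) +
        E * q * K₁ * Real.exp (-(b * y * d))) atTop
        (𝓝 (E * (1 - A * (1 - 0)) + E * q * K₁ * 0)) :=
      ((((hdec (b + 1 / α) (by positivity)).const_sub 1).const_mul A).const_sub 1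
        |>.const_mul E).add ((hdec b hb).const_mul _)
    rw [sub_zero, mul_one, mul_zero, add_zero] at hlim
    obtain ⟨y₁, hy₁⟩ := eventually_atTop.1 ((hlim.eventually_lt_const hτ3).and
      (eventually_ge_atTop 0))
    refine ⟨y₁, (hy₁ y₁ le_rfl).2, fun x hx y hy => ?_⟩
    obtain ⟨hy1, hy0⟩ := hy₁ y hy
    have hdisc := integral_discount_waitingLaw_le (α := α) hc hα hφ x hy0 hb hτ0.le
    have hmul := integral_discount_mul_exp_le hc hα.le hφ x hy0 hb.le τ
    have hΦ : φ (x + c * τ) ≤ Φ := hφ.monotone (by nlinarith)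
    have hA : A ≤ Real.exp (-(τ * φ (x + c * τ))) * (b * α / (1 + b * α)) := by
      simp only [A]; gcongr
    have hone : 0 ≤ 1 - Real.exp (-((b + 1 / α) * y * d)) := sub_nonneg.2
      (Real.exp_le_one_iff.2 (neg_nonpos.2 (by positivity)))
    have h1 : ∫ t, Real.exp (-(b * y * (1 - Real.exp (-α * t)))) ∂waitingLaw c α φ x y ≤
        1 - A * (1 - Real.exp (-((b + 1 / α) * y * d))) :=
      hdisc.trans (sub_le_sub_left (mul_le_mul_of_nonneg_right hA hone) _)
    calc _ ≤ E * ((1 - A * (1 - Real.exp (-((b + 1 / α) * y * d)))) +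
          q * Real.exp x * (Real.exp (c * τ) + Real.exp (-(b * y * d)) *
            ∫ t, Real.exp (c * t) ∂waitingLaw c α φ x y)) := by gcongr
      _ = E * (1 - A * (1 - Real.exp (-((b + 1 / α) * y * d)))) +
          E * q * (Real.exp x * ∫ t, Real.exp (c * t) ∂waitingLaw c α φ x y) *
            Real.exp (-(b * y * d)) + E * q * Real.exp (c * τ) * Real.exp x := by ring
      _ ≤ E * (1 - A * (1 - Real.exp (-((b + 1 / α) * y * d)))) +
          E * q * K₁ * Real.exp (-(b * y * d)) + γ * Real.exp x := by
        gcongr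
        exact hK₁ x hx y hy0
      _ ≤ γ * (1 + Real.exp x) := by linarith
  refine ⟨γ, Real.exp (b * (y₁ + k)) * (1 + q * K₁), hγ1, by positivity, fun w => ?_⟩
  have hy : (0 : ℝ) ≤ w.2 := w.2.coe_nonneg
  have := isProbabilityMeasure_waitingLaw (α := α) hc hφ w.1 hy
  have hK0 : 0 ≤ Real.exp (b * (y₁ + k)) * (1 + q * K₁) := by positivity
  have hV0 : 0 ≤ expLyapunov b w := by unfold expLyapunov; positivity
  rw [(integrable_expLyapunov_and_integral_eq ν hc hα.le hk.le hφ hν hb.le w).2, ← hq]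
  have hle1 : ∫ t, Real.exp (-(b * w.2 * (1 - Real.exp (-α * t)))) ∂waitingLaw c α φ w.1 w.2 ≤
      1 := by
    refine (integral_mono_ae (integrable_discount hc hα.le hφ w.1 hy hb.le) (integrable_const 1)
      ((ae_waitingLaw_pos _ _).mono fun t ht => ?_)).trans_eq (by simp)
    simpa using exp_discount_anti hα.le hy hb.le ht.le
  have hle2 : ∫ t, Real.exp (-(b * w.2 * (1 - Real.exp (-α * t)))) * Real.exp (c * t)
      ∂waitingLaw c α φ w.1 w.2 ≤ ∫ t, Real.exp (c * t) ∂waitingLaw c α φ w.1 w.2 := by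
    refine integral_mono_ae (integrable_discount_mul_exp hc hα.le hφ w.1 hy hb.le)
      (integrable_exp_waitingLaw hc hφ w.1 hy) ((ae_waitingLaw_pos _ _).mono fun t ht => ?_)
    refine mul_le_of_le_one_left (Real.exp_pos _).le ?_
    simpa using exp_discount_anti hα.le hy hb.le ht.le
  have hsplit : Real.exp (b * (w.2 + k)) = Real.exp (b * w.2) * E := by
    rw [hE, ← Real.exp_add, mul_add]
  have hmain : ∀ I J : ℝ, E * (I + q * Real.exp w.1 * J) ≤ γ * (1 + Real.exp w.1) →
      Real.exp (b * (w.2 + k)) * (I + q * Real.exp w.1 * J) ≤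
        γ * expLyapunov b w + Real.exp (b * (y₁ + k)) * (1 + q * K₁) := by
    intro I J h
    have h1 := mul_le_mul_of_nonneg_left h (Real.exp_pos (b * w.2)).le
    have h2 : Real.exp (b * w.2) * (γ * (1 + Real.exp w.1)) = γ * expLyapunov b w := by
      unfold expLyapunov; ring
    rw [hsplit, mul_assoc]
    linarith
  rcases le_total x₁ w.1 with hx | hx
  · refine hmain _ _ (le_trans ?_ (hx₁ w.1 hx w.2 hy))
    gcongr
  · rcases le_total y₁ w.2 with hyy | hyy
    · exact hmain _ _ (hy₁ w.1 hx w.2 hyy)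
    · refine le_add_of_nonneg_of_le (mul_nonneg hγ0.le hV0) ?_
      have h1 := hK₁ w.1 hx w.2 hy
      calc _ ≤ Real.exp (b * (y₁ + k)) *
            (1 + q * Real.exp w.1 * ∫ t, Real.exp (c * t) ∂waitingLaw c α φ w.1 w.2) := by gcongr
        _ = Real.exp (b * (y₁ + k)) *
            (1 + q * (Real.exp w.1 * ∫ t, Real.exp (c * t) ∂waitingLaw c α φ w.1 w.2)) := by ring
        _ ≤ _ := by gcongr

/-- The negative part of the stress grows at most by the mean release, and if it exceeds `c τ` it
also drops by `c τ` on the event that the waiting time exceeds `τ`. -/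
theorem negPart_drift (hc : 0 < c)
    (hφ : IsPrimaryRate φ) (hν : ∀ᵐ z ∂ν, 0 ≤ z) (hm : Integrable (fun z => z) ν)
    (w : ℝ × ℝ≥0) :
    Integrable (fun u : ℝ × ℝ≥0 => max (-u.1) 0) (embeddedKernel c α k hφ ν w) ∧
    (∫ u, max (-u.1) 0 ∂embeddedKernel c α k hφ ν w ≤ max (-w.1) 0 + ∫ z, z ∂ν) ∧
    ∀ τ, 0 ≤ τ → w.1 ≤ -(c * τ) → ∫ u, max (-u.1) 0 ∂embeddedKernel c α k hφ ν w ≤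
      max (-w.1) 0 + ∫ z, z ∂ν - c * τ * survival c α φ w.1 w.2 τ := by
  have hy : (0 : ℝ) ≤ w.2 := w.2.coe_nonneg
  have := isProbabilityMeasure_waitingLaw (α := α) hc hφ w.1 hy
  set L := waitingLaw c α φ w.1 w.2 with hL
  have hmeas := (measurable_nextState_apply c α k w).aemeasurable (μ := L.prod ν)
  have hV : Measurable (fun u : ℝ × ℝ≥0 => max (-u.1) 0) := by fun_prop
  have hpos : ∀ᵐ p ∂L.prod ν, 0 < p.1 ∧ 0 ≤ p.2 :=
    (Measure.quasiMeasurePreserving_fst.ae (ae_waitingLaw_pos _ _)).and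
      (Measure.quasiMeasurePreserving_snd.ae hν)
  have hbd : ∀ᵐ p ∂L.prod ν, max (-(w.1 + c * p.1 - p.2)) 0 ≤ max (-w.1) 0 + p.2 := by
    filter_upwards [hpos] with p hp
    have := mul_pos hc hp.1
    exact max_le (by linarith [le_max_left (-w.1) 0]) (by linarith [le_max_right (-w.1) 0, hp.2])
  have hi0 : Integrable (fun p : ℝ × ℝ => max (-w.1) 0 + p.2) (L.prod ν) :=
    (integrable_const _).add (hm.comp_snd L)
  have hi : Integrable (fun p : ℝ × ℝ => max (-(w.1 + c * p.1 - p.2)) 0) (L.prod ν) := by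
    refine hi0.mono' (by fun_prop) (hbd.mono fun p hp => ?_)
    rwa [Real.norm_of_nonneg (le_max_right _ _)]
  have e0 : ∫ p : ℝ × ℝ, (max (-w.1) 0 + p.2) ∂L.prod ν = max (-w.1) 0 + ∫ z, z ∂ν := by
    have e := integral_fun_snd (μ := L) (ν := ν) (fun z => z)
    rw [integral_add (integrable_const _) (hm.comp_snd L), e]
    simp
  rw [embeddedKernel_apply, integral_map hmeas hV.aestronglyMeasurable,
    integrable_map_measure hV.aestronglyMeasurable hmeas]
  simp only [Function.comp_def, nextState_fst]
  refine ⟨hi, e0 ▸ integral_mono_ae hi hi0 hbd, fun τ hτ hx => ?_⟩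
  have hS : (L.prod ν).real (Prod.fst ⁻¹' Set.Ioi τ) = survival c α φ w.1 w.2 τ := by
    rw [measureReal_def, ← Set.prod_univ, Measure.prod_prod, measure_univ, mul_one, hL,
      waitingLaw_Ioi hc hφ _ hy hτ, ENNReal.toReal_ofReal (survival_nonneg _ _ _)]
  have hms : MeasurableSet (Prod.fst ⁻¹' Set.Ioi τ : Set (ℝ × ℝ)) :=
    measurable_fst measurableSet_Ioi
  have hi1 : Integrable ((Prod.fst ⁻¹' Set.Ioi τ).indicator fun _ : ℝ × ℝ => c * τ) (L.prod ν) :=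
    (integrable_const _).indicator hms
  rw [← hS, ← e0, mul_comm (c * τ), ← smul_eq_mul _ (c * τ), ← integral_indicator_const _ hms,
    ← integral_sub hi0 hi1]
  refine integral_mono_ae hi (hi0.sub hi1) ?_
  filter_upwards [hpos, hbd] with p hp hp2
  by_cases h : p ∈ Prod.fst ⁻¹' Set.Ioi τ
  · have h' : τ < p.1 := h
    have := mul_lt_mul_of_pos_left h' hc
    simp only [Set.indicator_of_mem h]
    exact max_le (by linarith [le_max_left (-w.1) 0])
      (by linarith [le_max_left (-w.1) 0, hp.2])
  · simpa [Set.indicator_of_notMem h] using hp2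

/-- The growth of the Lyapunov function is bounded, and off suitable compact sets its drift is below
any given level. -/
theorem exists_lyapunov (hc : 0 < c) (hk : 0 < k) (hkα : k < α)
    (hφ : IsPrimaryRate φ) (hν : ∀ᵐ z ∂ν, 0 ≤ z) (hm : Integrable (fun z => z) ν)
    (hCZ : ConditionCZ ν) :
    ∃ V : ℝ × ℝ≥0 → ℝ, Measurable V ∧ (∀ w, 0 ≤ V w) ∧
      (∀ w, Integrable V (embeddedKernel c α k hφ ν w)) ∧ ∃ B : ℝ, 0 ≤ B ∧
      (∀ w, ∫ u, V u ∂embeddedKernel c α k hφ ν w ≤ V w + B) ∧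
      ∀ D : ℝ, ∃ R : ℝ, 0 ≤ R ∧ ∀ w : ℝ × ℝ≥0, (R < |w.1| ∨ R < w.2) →
        ∫ u, V u ∂embeddedKernel c α k hφ ν w ≤ V w - D := by
  have hα : 0 < α := hk.trans hkα
  obtain ⟨b, hb, hbq, hbα⟩ := exists_discount_rate hk hkα (integral_exp_neg_lt_one ν hν hCZ)
  obtain ⟨γ, K, hγ, hK, hd⟩ := expLyapunov_drift ν hc hα hk hφ hν hb hbq hbα
  have hneg := negPart_drift (α := α) (k := k) ν hc hφ hν hm
  have hi1 := fun w => (integrable_expLyapunov_and_integral_eq ν hc hα.le hk.le hφ hν hb.le w).1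
  set m := ∫ z, z ∂ν
  have hm0 : 0 ≤ m := integral_nonneg_of_ae hν
  have hV1 : ∀ w, 0 ≤ expLyapunov b w := fun w => by unfold expLyapunov; positivity
  have hadd : ∀ w, ∫ u, (expLyapunov b u + max (-u.1) 0) ∂embeddedKernel c α k hφ ν w =
      ∫ u, expLyapunov b u ∂embeddedKernel c α k hφ ν w +
        ∫ u, max (-u.1) 0 ∂embeddedKernel c α k hφ ν w :=
    fun w => integral_add (hi1 w) (hneg w).1
  refine ⟨fun w => expLyapunov b w + max (-w.1) 0, by unfold expLyapunov; fun_prop,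
    fun w => add_nonneg (hV1 w) (le_max_right _ _), fun w => (hi1 w).add (hneg w).1, K + m,
    by positivity, fun w => ?_, fun D => ?_⟩
  · rw [hadd]
    have := mul_le_mul_of_nonneg_right hγ.le (hV1 w)
    linarith [hd w, (hneg w).2.1]
  · have hγ' : 0 < 1 - γ := sub_pos.2 hγ
    let M := max ((K + m + D) / (1 - γ)) 0
    have hM0 : 0 ≤ M := le_max_right _ _
    have hM : K + m + D ≤ (1 - γ) * M := by
      have := (div_le_iff₀ hγ').1 (le_max_left ((K + m + D) / (1 - γ)) 0)
      rwa [mul_comm] at this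
    -- for `y ≤ M / b` and `x` close to `-∞`, the waiting time exceeds `τ` with probability at least `p`
    let p := Real.exp (-1) * Real.exp (-(M / b / α))
    have hp : 0 < p := by positivity
    let τ := max ((K + m + D) / (c * p)) 0
    have hτ0 : 0 ≤ τ := le_max_right _ _
    have hτ : K + m + D ≤ c * τ * p := by
      have := (div_le_iff₀ (mul_pos hc hp)).1 (le_max_left ((K + m + D) / (c * p)) 0)
      calc K + m + D ≤ τ * (c * p) := this
        _ = c * τ * p := by ring
    have hφτ : ∀ᶠ x in atBot, τ * φ (x + c * τ) < 1 := by
      have h1 : Tendsto (fun x => τ * φ (x + c * τ)) atBot (𝓝 (τ * 0)) :=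
        (hφ.tendsto_atBot.comp (tendsto_atBot_add_const_right _ (c * τ) tendsto_id)).const_mul τ
      rw [mul_zero] at h1
      exact h1.eventually_lt_const zero_lt_one
    obtain ⟨x₂, hx₂⟩ := eventually_atBot.1 (hφτ.and (eventually_le_atBot (-(c * τ))))
    refine ⟨max (max M (M / b)) (-x₂), le_max_of_le_left (le_max_of_le_left hM0),
      fun w hw => ?_⟩
    have hR1 : M ≤ max (max M (M / b)) (-x₂) := le_max_of_le_left (le_max_left _ _)
    have hR2 : M / b ≤ max (max M (M / b)) (-x₂) := le_max_of_le_left (le_max_right _ _)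
    have hR3 : -x₂ ≤ max (max M (M / b)) (-x₂) := le_max_right _ _
    rw [hadd]
    rcases le_or_gt M (expLyapunov b w) with h | h
    · have := mul_le_mul_of_nonneg_left h hγ'.le
      linarith [hd w, (hneg w).2.1]
    · have hy0 : (0 : ℝ) ≤ w.2 := w.2.coe_nonneg
      have hy : b * w.2 < M := by
        have h1 := Real.add_one_le_exp (b * w.2)
        have h2 := mul_pos (Real.exp_pos (b * w.2)) (Real.exp_pos w.1)
        unfold expLyapunov at h
        linarith
      have hx : w.1 < M := by
        have h1 := Real.add_one_le_exp w.1
        have h2 : 1 * (1 + Real.exp w.1) ≤ Real.exp (b * w.2) * (1 + Real.exp w.1) := by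
          gcongr
          exact Real.one_le_exp (by positivity)
        unfold expLyapunov at h
        linarith
      have hy' : (w.2 : ℝ) < M / b := (lt_div_iff₀ hb).2 (by linarith)
      have hx' : w.1 ≤ x₂ := by
        rcases hw with hw | hw
        · rcases lt_abs.1 hw with hw | hw <;> linarith
        · linarith
      obtain ⟨h3, h4⟩ := hx₂ w.1 hx'
      have h5 := (hneg w).2.2 τ hτ0 h4
      have h6 : p ≤ survival c α φ w.1 w.2 τ := by
        refine le_trans ?_ (le_survival hc.le hα.ne' hφ w.1 w.2 hτ0 le_rfl)
        have h7 : w.2 * ((1 - Real.exp (-α * τ)) / α) ≤ M / b / α := by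
          rw [div_eq_mul_one_div (M / b) α]
          have : 0 ≤ (1 - Real.exp (-α * τ)) / α := div_nonneg
            (sub_nonneg.2 (Real.exp_le_one_iff.2 (by nlinarith))) hα.le
          refine mul_le_mul hy'.le ?_ this (hy0.trans hy'.le)
          gcongr
          linarith [Real.exp_pos (-α * τ)]
        simp only [p]
        gcongr
      have h8 : c * τ * p ≤ c * τ * survival c α φ w.1 w.2 τ := by gcongr
      have := mul_le_mul_of_nonneg_right hγ.le (hV1 w)
      linarith [hd w]

end Kernel
end Drift

/-! ### The minorization of the two-step kernel -/

section Minorization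

theorem setLIntegral_le_mul_of_subset_image {s t : Set ℝ} (hs : MeasurableSet s) {f f' : ℝ → ℝ}
    {M : ℝ} (hf : ∀ x ∈ s, HasDerivAt f (f' x) x) (hinj : Set.InjOn f s) (hM : ∀ x ∈ s, |f' x| ≤ M)
    (hts : t ⊆ f '' s) (g : ℝ → ℝ≥0∞) :
    ∫⁻ y in t, g y ≤ ENNReal.ofReal M * ∫⁻ x in s, g (f x) := by
  refine (lintegral_mono_set hts).trans ?_
  rw [lintegral_image_eq_lintegral_abs_deriv_mul hs (fun x hx => (hf x hx).hasDerivWithinAt) hinj,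
    ← lintegral_const_mul' _ _ ENNReal.ofReal_ne_top]
  exact setLIntegral_mono' hs fun x hx => by gcongr; exact hM x hx

variable {c α k : ℝ} {φ : ℝ → ℝ}

/-- For fixed releases `z₁, z₂`, change variables from the waiting times `(t₁, t₂)` to the state
`(X, Y)` after two shocks, in two steps: `t₁ + t₂` determines `X`, and then `t₂` determines `Y`.
The Jacobian is at most `c α k`, and the image covers the rectangle on the left, uniformly in the
initial states `w` whose second coordinate contributes at most `δ` after the time `a + 1`. -/
theorem lintegral_rect_le_lintegral_nextState (hc : 0 < c) (hα : 0 < α) (hk : 0 < k)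
    {w : ℝ × ℝ≥0} {z₁ z₂ X₀ X₁ a b δ : ℝ}
    (hδ : w.2 * Real.exp (-α * (a + 1)) ≤ δ)
    (hX₀ : w.1 + c * (a + 1) ≤ X₀ + (z₁ + z₂)) (hX₁ : X₁ + (z₁ + z₂) ≤ w.1 + c * b)
    {f : ℝ × ℝ≥0 → ℝ≥0∞} (hf : Measurable f) :
    ∫⁻ X in Set.Ioc X₀ X₁, ∫⁻ Y in Set.Ioo (k + δ + k * Real.exp (-α)) (2 * k),
        f (X, Y.toNNReal) ≤
      ENNReal.ofReal c * (ENNReal.ofReal (α * k) * ∫⁻ t₁ in Set.Ioc a b, ∫⁻ t₂ in Set.Ioc 0 1,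
        f (nextState c α k (nextState c α k w t₁ z₁) t₂ z₂)) := by
  have hw : (0 : ℝ) ≤ w.2 := w.2.coe_nonneg
  let g : ℝ → ℝ → ℝ≥0∞ := fun U t => f (w.1 + c * U - (z₁ + z₂),
    (w.2 * Real.exp (-α * U) + k * Real.exp (-α * t) + k).toNNReal)
  have hg : Measurable (Function.uncurry g) := by
    refine hf.comp (Measurable.prodMk (by fun_prop) (by fun_prop))
  have hnext : ∀ t₁ t₂, f (nextState c α k (nextState c α k w t₁ z₁) t₂ z₂) = g (t₁ + t₂) t₂ := by
    intro t₁ t₂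
    simp only [g]
    rw [nextState, coe_nextState_snd hk.le, nextState_fst]
    congr 2
    · ring
    · rw [mul_add, Real.exp_add]
      congr 1
      ring
  have hderiv : ∀ t, HasDerivAt (fun s : ℝ => Real.exp (-α * s)) (Real.exp (-α * t) * -α) t :=
    fun t => by
      have h1 : HasDerivAt (fun s : ℝ => -α * s) (-α) t := by
        simpa using (hasDerivAt_id t).const_mul (-α)
      exact h1.exp
  calc ∫⁻ X in Set.Ioc X₀ X₁, ∫⁻ Y in Set.Ioo (k + δ + k * Real.exp (-α)) (2 * k),
        f (X, Y.toNNReal)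
      ≤ ENNReal.ofReal c * ∫⁻ U in Set.Ioc (a + 1) b,
          ∫⁻ Y in Set.Ioo (k + δ + k * Real.exp (-α)) (2 * k),
            f (w.1 + c * U - (z₁ + z₂), Y.toNNReal) := by
        refine setLIntegral_le_mul_of_subset_image measurableSet_Ioc
          (f := fun U => w.1 + c * U - (z₁ + z₂)) (f' := fun _ => c) (fun U _ => ?_)
          (fun U _ U' _ h => ?_) (fun U _ => (abs_of_pos hc).le) (fun X hX => ?_) _
        · simpa using (((hasDerivAt_id U).const_mul c).const_add w.1).sub_const (z₁ + z₂)
        · have h : w.1 + c * U - (z₁ + z₂) = w.1 + c * U' - (z₁ + z₂) := h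
          exact mul_left_cancel₀ hc.ne' (by linarith)
        · refine ⟨(X + (z₁ + z₂) - w.1) / c, ⟨?_, ?_⟩, ?_⟩
          · rw [lt_div_iff₀ hc]; linarith [hX.1]
          · rw [div_le_iff₀ hc]; linarith [hX.2]
          · simp only; field_simp; ring
    _ ≤ ENNReal.ofReal c * ∫⁻ U in Set.Ioc (a + 1) b,
          ENNReal.ofReal (α * k) * ∫⁻ t in Set.Ioc 0 1, g U t := by
        gcongr _ * ?_
        refine setLIntegral_mono' measurableSet_Ioc fun U hU => ?_
        have hA0 : 0 ≤ w.2 * Real.exp (-α * U) := by positivity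
        have hA1 : w.2 * Real.exp (-α * U) ≤ δ := by
          refine le_trans ?_ hδ
          gcongr ?_ * Real.exp ?_
          nlinarith [hU.1]
        refine setLIntegral_le_mul_of_subset_image measurableSet_Ioc
          (f := fun t => w.2 * Real.exp (-α * U) + k * Real.exp (-α * t) + k)
          (f' := fun t => k * (Real.exp (-α * t) * -α))
          (fun t _ => (((hderiv t).const_mul k).const_add _).add_const _)
          (fun t _ t' _ h => ?_) (fun t ht => ?_) (fun Y hY => ?_) _
        · have h : w.2 * Real.exp (-α * U) + k * Real.exp (-α * t) + k =
            w.2 * Real.exp (-α * U) + k * Real.exp (-α * t') + k := h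
          have h2 : Real.exp (-α * t) = Real.exp (-α * t') :=
            mul_left_cancel₀ hk.ne' (by linarith)
          exact mul_left_cancel₀ (neg_ne_zero.2 hα.ne') (Real.exp_injective h2)
        · have h1 : Real.exp (-α * t) ≤ 1 := Real.exp_le_one_iff.2 (by nlinarith [ht.1])
          rw [abs_mul, abs_mul, abs_of_pos hk, abs_of_pos (Real.exp_pos _), abs_neg, abs_of_pos hα]
          nlinarith [mul_pos hk hα]
        · let v := (Y - k - w.2 * Real.exp (-α * U)) / k
          have hv1 : v < 1 := (div_lt_one hk).2 (by linarith [hY.2])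
          have hv2 : Real.exp (-α) ≤ v := (le_div_iff₀ hk).2 (by linarith [hY.1])
          have hv0 : 0 < v := (Real.exp_pos _).trans_le hv2
          have hl1 : Real.log v < 0 := Real.log_neg hv0 hv1
          have hl2 : -α ≤ Real.log v := (Real.le_log_iff_exp_le hv0).2 hv2
          refine ⟨-Real.log v / α, ⟨div_pos (by linarith) hα, (div_le_one hα).2 (by linarith)⟩, ?_⟩
          have e1 : -α * (-Real.log v / α) = Real.log v := by field_simp
          have e2 : k * v = Y - k - w.2 * Real.exp (-α * U) := mul_div_cancel₀ _ hk.ne'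
          simp only
          rw [e1, Real.exp_log hv0, e2]
          ring
    _ = ENNReal.ofReal c * (ENNReal.ofReal (α * k) *
          ∫⁻ t in Set.Ioc 0 1, ∫⁻ U in Set.Ioc (a + 1) b, g U t) := by
        rw [lintegral_const_mul' _ _ ENNReal.ofReal_ne_top, lintegral_lintegral_swap hg.aemeasurable]
    _ ≤ ENNReal.ofReal c * (ENNReal.ofReal (α * k) *
          ∫⁻ t in Set.Ioc 0 1, ∫⁻ t₁ in Set.Ioc a b, g (t₁ + t) t) := by
        gcongr _ * (_ * ?_)
        refine setLIntegral_mono' measurableSet_Ioc fun t ht => ?_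
        have := setLIntegral_le_mul_of_subset_image (s := Set.Ioc a b) (t := Set.Ioc (a + 1) b)
          measurableSet_Ioc (f := fun t₁ => t₁ + t) (f' := fun _ => 1) (M := 1)
          (fun t₁ _ => (hasDerivAt_id t₁).add_const t) (fun _ _ _ _ h => add_right_cancel h)
          (fun _ _ => by simp) (fun U hU => ⟨U - t, ⟨by linarith [hU.1, ht.2], by
            linarith [hU.2, ht.1]⟩, by simp⟩) (fun U => g U t)
        simpa using this
    _ = _ := by
        rw [lintegral_lintegral_swap]
        · simp only [hnext]
        · have : Measurable fun p : ℝ × ℝ => (p.2 + p.1, p.1) := by fun_prop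
          exact (hg.comp this).aemeasurable

/-- A lower bound of the hazard rate gives a lower bound of the density of the waiting time, uniformly
in initial states `(x, y)` with `x ≤ x'` and `y ≤ y'`. -/
theorem smul_restrict_le_waitingLaw (hc : 0 ≤ c) (hα : 0 < α) (hφ : IsPrimaryRate φ)
    {x y x' y' a b η : ℝ} (hx : x ≤ x') (hy : 0 ≤ y) (hy' : y ≤ y') (ha : 0 ≤ a) (hη0 : 0 ≤ η)
    (hη : ∀ t ∈ Set.Ioc a b, η ≤ hazard c α φ x y t) :
    ENNReal.ofReal (η * (Real.exp (-(b * φ (x' + c * b))) * Real.exp (-(y' / α)))) •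
      volume.restrict (Set.Ioc a b) ≤ waitingLaw c α φ x y := by
  rw [← withDensity_const, waitingLaw]
  refine le_trans ?_ (Measure.restrict_le_self (s := Set.Ioc a b))
  rw [restrict_withDensity measurableSet_Ioc, Measure.restrict_restrict measurableSet_Ioc,
    Set.inter_eq_left.2 (Set.Ioc_subset_Ioi_self.trans (Set.Ioi_subset_Ioi ha))]
  refine withDensity_mono ((ae_restrict_iff' measurableSet_Ioc).2 (Eventually.of_forall
    fun t ht => ENNReal.ofReal_le_ofReal ?_))
  have ht0 : 0 ≤ t := ha.trans ht.1.le
  have h1 := le_survival (α := α) hc hα.ne' hφ x y ht0 ht.2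
  have h2 : φ (x + c * b) ≤ φ (x' + c * b) := hφ.monotone (by linarith)
  have h3 : y * ((1 - Real.exp (-α * t)) / α) ≤ y' / α := by
    rw [div_eq_mul_one_div y' α]
    have : 0 ≤ (1 - Real.exp (-α * t)) / α := div_nonneg
      (sub_nonneg.2 (Real.exp_le_one_iff.2 (by nlinarith))) hα.le
    refine mul_le_mul hy' ?_ this (hy.trans hy')
    gcongr
    linarith [Real.exp_pos (-α * t)]
  have hb : 0 ≤ b := ht0.trans ht.2
  refine mul_le_mul (hη t ht) (le_trans ?_ h1) (by positivity) (hη0.trans (hη t ht))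
  gcongr

variable (ν : Measure ℝ) [IsProbabilityMeasure ν]

theorem mul_lintegral_le_lintegral_embeddedKernel (hc : 0 < c) (hφ : IsPrimaryRate φ)
    {w : ℝ × ℝ≥0} {η : ℝ≥0∞} {s : Set ℝ}
    (h : η • volume.restrict s ≤ waitingLaw c α φ w.1 w.2) (J : Set ℝ)
    {f : ℝ × ℝ≥0 → ℝ≥0∞} (hf : Measurable f) :
    η * ∫⁻ z in J, (∫⁻ t in s, f (nextState c α k w t z)) ∂ν ≤
      ∫⁻ u, f u ∂embeddedKernel c α k hφ ν w := by
  have := isProbabilityMeasure_waitingLaw (α := α) hc hφ w.1 w.2.coe_nonneg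
  have hm := measurable_nextState_apply c α k w
  rw [embeddedKernel_apply, lintegral_map hf hm, 
    lintegral_prod_symm' (fun q : ℝ × ℝ => f (nextState c α k w q.1 q.2)) (hf.comp hm)]
  have hmeas : Measurable fun z => ∫⁻ t in s, f (nextState c α k w t z) :=
    (hf.comp hm).lintegral_prod_left'
  rw [← lintegral_const_mul _ hmeas]
  refine (setLIntegral_le_lintegral _ _).trans (lintegral_mono fun z => ?_)
  rw [← smul_eq_mul, ← lintegral_smul_measure]
  exact lintegral_mono' h le_rfl

/-- Compact sets are small for the two-step kernel. -/
theorem exists_le_comp_embeddedKernel (hc : 0 < c) (hα : 0 < α) (hk : 0 < k)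
    (hφ : IsPrimaryRate φ) (hCZ : ConditionCZ ν) (R : ℝ) :
    ∃ ρ : Measure (ℝ × ℝ≥0), ρ ≠ 0 ∧ ∀ w : ℝ × ℝ≥0, |w.1| ≤ R → w.2 ≤ R →
      ρ ≤ (embeddedKernel c α k hφ ν ∘ₖ embeddedKernel c α k hφ ν) w := by
  obtain ⟨ζ₁, ζ₂, h, hζ₁, hζ, hh, hCZ⟩ := hCZ
  set J := Set.Icc ζ₁ ζ₂
  have hJ : ν J ≠ 0 := by
    intro h0
    have := hCZ ζ₁ ζ₂ le_rfl hζ.le le_rfl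
    rw [measureReal_def, h0, ENNReal.toReal_zero] at this
    nlinarith
  -- `δ` leaves room for the contribution of the initial state to the second coordinate
  let δ := k * (1 - Real.exp (-α)) / 2
  have hexp : Real.exp (-α) < 1 := by simpa using Real.exp_lt_exp.2 (neg_lt_zero.2 hα)
  have hδ0 : 0 < δ := div_pos (mul_pos hk (by linarith)) two_pos
  obtain ⟨a, ha0, haφ, haδ⟩ : ∃ a : ℝ, 0 ≤ a ∧ 1 ≤ φ (-R + c * a) ∧
      R * Real.exp (-α * (a + 1)) ≤ δ := by
    have h1 : Tendsto (fun a => φ (-R + c * a)) atTop atTop := hφ.tendsto_atTop.comp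
      (tendsto_atTop_add_const_left _ _ (tendsto_id.const_mul_atTop hc))
    have h2 : Tendsto (fun a : ℝ => R * Real.exp (-α * (a + 1))) atTop (𝓝 (R * 0)) :=
      (Real.tendsto_exp_atBot.comp ((tendsto_atTop_add_const_right _ (1 : ℝ)
        tendsto_id).const_mul_atTop_of_neg (neg_lt_zero.2 hα))).const_mul R
    rw [mul_zero] at h2
    obtain ⟨a, h3, h4, h5⟩ := ((eventually_ge_atTop 0).and
      ((h1.eventually_ge_atTop 1).and (h2.eventually_le_const hδ0))).exists
    exact ⟨a, h3, h4, h5⟩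
  let X₀ := R + c * (a + 1)
  let b := (X₀ + 1 + R + 2 * ζ₂) / c
  have hb : c * b = X₀ + 1 + R + 2 * ζ₂ := mul_div_cancel₀ _ hc.ne'
  let η₁ := ENNReal.ofReal (1 * (Real.exp (-(b * φ (R + c * b))) * Real.exp (-(R / α))))
  let η₂ := ENNReal.ofReal (k * Real.exp (-α) *
    (Real.exp (-(1 * φ (R + c * b + c * 1))) * Real.exp (-((R + k) / α))))
  have hη₁ : η₁ ≠ 0 := (ENNReal.ofReal_pos.2 (by positivity)).ne'
  have hη₂ : η₂ ≠ 0 := (ENNReal.ofReal_pos.2 (by positivity)).ne'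
  let m : Measure (ℝ × ℝ≥0) := ((volume.restrict (Set.Ioc X₀ (X₀ + 1))).prod
    (volume.restrict (Set.Ioo (k + δ + k * Real.exp (-α)) (2 * k)))).map
      fun p => (p.1, p.2.toNNReal)
  have hmm : Measurable fun p : ℝ × ℝ => (p.1, p.2.toNNReal) := by fun_prop
  have hm0 : m Set.univ ≠ 0 := by
    rw [Measure.map_apply hmm .univ, Set.preimage_univ, ← Set.univ_prod_univ, Measure.prod_prod]
    simp only [Measure.restrict_apply_univ, Real.volume_Ioc, Real.volume_Ioo]
    refine mul_ne_zero (ENNReal.ofReal_pos.2 (by linarith)).ne' (ENNReal.ofReal_pos.2 ?_).ne'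
    have : 2 * k - (k + δ + k * Real.exp (-α)) = δ := by simp only [δ]; ring
    rwa [this]
  let C := ENNReal.ofReal c * ENNReal.ofReal (α * k)
  have hC0 : C ≠ 0 := mul_ne_zero (ENNReal.ofReal_pos.2 hc).ne'
    (ENNReal.ofReal_pos.2 (by positivity)).ne'
  have hCt : C ≠ ∞ := ENNReal.mul_ne_top ENNReal.ofReal_ne_top ENNReal.ofReal_ne_top
  refine ⟨(η₁ * (η₂ * (ν J * ν J)) * C⁻¹) • m, ?_, fun w hwx hwy => ?_⟩
  · intro h0
    have := congrArg (fun μ : Measure (ℝ × ℝ≥0) => μ Set.univ) h0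
    simp only [Measure.smul_apply, smul_eq_mul, Measure.coe_zero, Pi.zero_apply, mul_eq_zero,
      hη₁, hη₂, hJ, hm0, ENNReal.inv_eq_zero, hCt, or_self] at this
  · have hw0 : (0 : ℝ) ≤ w.2 := w.2.coe_nonneg
    have hx := abs_le.1 hwx
    refine Measure.le_iff.2 fun B hB => ?_
    let f : ℝ × ℝ≥0 → ℝ≥0∞ := B.indicator 1
    have hf : Measurable f := measurable_one.indicator hB
    rw [Kernel.comp_apply' _ _ _ hB, Measure.smul_apply, smul_eq_mul]
    have hmB : m B = ∫⁻ X in Set.Ioc X₀ (X₀ + 1),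
        ∫⁻ Y in Set.Ioo (k + δ + k * Real.exp (-α)) (2 * k), f (X, Y.toNNReal) := by
      rw [← lintegral_indicator_one hB, lintegral_map hf hmm]
      exact lintegral_prod _ (hf.comp hmm).aemeasurable
    have hstep₁ : η₁ • volume.restrict (Set.Ioc a b) ≤ waitingLaw c α φ w.1 w.2 :=
      smul_restrict_le_waitingLaw hc.le hα hφ hx.2 hw0 hwy ha0 zero_le_one fun t ht =>
        haφ.trans ((hφ.monotone (by nlinarith [ht.1])).trans
          (le_add_of_nonneg_right (by positivity)))
    have hstep₂ : ∀ z₁ ∈ J, ∀ t₁ ∈ Set.Ioc a b, η₂ • volume.restrict (Set.Ioc 0 1) ≤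
        waitingLaw c α φ (nextState c α k w t₁ z₁).1 (nextState c α k w t₁ z₁).2 := by
      intro z₁ hz₁ t₁ ht₁
      have hsnd : ((nextState c α k w t₁ z₁).2 : ℝ) = w.2 * Real.exp (-α * t₁) + k :=
        coe_nextState_snd hk.le _ _ _
      have h1 : Real.exp (-α * t₁) ≤ 1 := Real.exp_le_one_iff.2 (by nlinarith [ht₁.1])
      have h2 : 0 ≤ w.2 * Real.exp (-α * t₁) := by positivity
      refine smul_restrict_le_waitingLaw hc.le hα hφ ?_ (NNReal.coe_nonneg _) ?_ le_rfl
        (by positivity) fun t ht => ?_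
      · rw [nextState_fst]
        nlinarith [ht₁.2, hz₁.1]
      · rw [hsnd]
        nlinarith
      · refine le_trans ?_ (le_add_of_nonneg_left (hφ.nonneg _))
        rw [hsnd]
        have : -α ≤ -α * t := by nlinarith [ht.2]
        gcongr
        linarith
    have hG : Measurable fun p : (ℝ × ℝ) × ℝ × ℝ =>
        f (nextState c α k (nextState c α k w p.1.2 p.1.1) p.2.2 p.2.1) := by
      unfold nextState
      exact hf.comp (by fun_prop)
    -- two transitions, each with its waiting time confined to an interval
    calc η₁ * (η₂ * (ν J * ν J)) * C⁻¹ * m B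
        = η₁ * (η₂ * ∫⁻ _ in J, ∫⁻ _ in J, C⁻¹ * m B ∂ν ∂ν) := by
          simp only [lintegral_const, Measure.restrict_apply_univ]
          ring
      _ ≤ η₁ * (η₂ * ∫⁻ z₁ in J, ∫⁻ z₂ in J, (∫⁻ t₁ in Set.Ioc a b, ∫⁻ t₂ in Set.Ioc 0 1,
            f (nextState c α k (nextState c α k w t₁ z₁) t₂ z₂)) ∂ν ∂ν) := by
          gcongr _ * (_ * ?_)
          refine setLIntegral_mono' measurableSet_Icc fun z₁ hz₁ => ?_
          refine setLIntegral_mono' measurableSet_Icc fun z₂ hz₂ => ?_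
          rw [ENNReal.inv_mul_le_iff hC0 hCt, hmB, mul_assoc]
          refine lintegral_rect_le_lintegral_nextState hc hα hk (le_trans ?_ haδ) ?_ ?_ hf
          · gcongr
          · simp only [X₀]
            linarith [hz₁.1, hz₂.1]
          · rw [hb]
            linarith [hz₁.2, hz₂.2]
      _ = η₁ * ∫⁻ z₁ in J, (∫⁻ t₁ in Set.Ioc a b, η₂ * ∫⁻ z₂ in J, (∫⁻ t₂ in Set.Ioc 0 1,
            f (nextState c α k (nextState c α k w t₁ z₁) t₂ z₂)) ∂ν) ∂ν := by
          rw [← lintegral_const_mul' _ _ ENNReal.ofReal_ne_top]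
          congr 1
          refine lintegral_congr fun z₁ => ?_
          rw [lintegral_const_mul' _ _ ENNReal.ofReal_ne_top]
          refine congrArg (η₂ * ·) (lintegral_lintegral_swap ?_)
          have h1 : Measurable fun q : (ℝ × ℝ) × ℝ => (((z₁, q.1.2), (q.1.1, q.2)) :
              (ℝ × ℝ) × ℝ × ℝ) := by fun_prop
          exact (hG.comp h1).lintegral_prod_right'.aemeasurable
      _ ≤ η₁ * ∫⁻ z₁ in J, (∫⁻ t₁ in Set.Ioc a b,
            embeddedKernel c α k hφ ν (nextState c α k w t₁ z₁) B) ∂ν := by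
          gcongr _ * ?_
          refine setLIntegral_mono' measurableSet_Icc fun z₁ hz₁ => ?_
          refine setLIntegral_mono' measurableSet_Ioc fun t₁ ht₁ => ?_
          rw [← lintegral_indicator_one hB]
          exact mul_lintegral_le_lintegral_embeddedKernel ν hc hφ (hstep₂ z₁ hz₁ t₁ ht₁) J hf
      _ ≤ _ := mul_lintegral_le_lintegral_embeddedKernel ν hc hφ hstep₁ J
          (Kernel.measurable_coe _ hB)

theorem isHarrisErgodic_embeddedKernel (hc : 0 < c) (hk : 0 < k) (hkα : k < α)
    (hφ : IsPrimaryRate φ) (hν : ∀ᵐ z ∂ν, 0 ≤ z) (hm : Integrable (fun z => z) ν)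
    (hCZ : ConditionCZ ν) : IsHarrisErgodic (embeddedKernel c α k hφ ν) := by
  have := isMarkovKernel_embeddedKernel (α := α) (k := k) hc hφ ν
  obtain ⟨V, hV, hV0, hi, b, hb, hgrowth, hdrift⟩ := exists_lyapunov ν hc hk hkα hφ hν hm hCZ
  obtain ⟨R, hR0, hR⟩ := hdrift (3 * b + 1)
  obtain ⟨ρ, hρ0, hρ⟩ := exists_le_comp_embeddedKernel ν hc (hk.trans hkα) hk hφ hCZ R
  let C : Set (ℝ × ℝ≥0) := {w | |w.1| ≤ R} ∩ {w | (w.2 : ℝ) ≤ R}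
  have hC : MeasurableSet C :=
    (measurableSet_le (by fun_prop) measurable_const).inter
      (measurableSet_le (by fun_prop) measurable_const)
  have hC0 : (0, 0) ∈ C := by simp [C, hR0]
  have hρf : IsFiniteMeasure ρ := isFiniteMeasure_of_le _ (hρ (0, 0) hC0.1 hC0.2)
  have hρu : ρ Set.univ ≠ 0 := by simpa using hρ0
  have hprob : IsProbabilityMeasure ((ρ Set.univ)⁻¹ • ρ) := ⟨by
    rw [Measure.smul_apply, smul_eq_mul, ENNReal.inv_mul_cancel hρu (measure_ne_top _ _)]⟩
  refine isHarrisErgodic_of_drift_of_minorization hV hV0 hb hC ⟨_, hC0⟩ hi hgrowth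
    (fun w hw => hR w ?_) (ε := (ρ Set.univ).toNNReal) (ENNReal.toNNReal_pos hρu
      (measure_ne_top _ _)) (ρ := (ρ Set.univ)⁻¹ • ρ) fun w hw => ?_
  · by_contra! h
    exact hw h
  · refine le_trans (le_of_eq ?_) (hρ w hw.1 hw.2)
    change ((ρ Set.univ).toNNReal : ℝ≥0∞) • (ρ Set.univ)⁻¹ • ρ = ρ
    rw [ENNReal.coe_toNNReal (measure_ne_top _ _), smul_smul,
      ENNReal.mul_inv_cancel hρu (measure_ne_top _ _), one_smul]

end Minorization

/-! ### The shocks form a Markov chain -/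

section Chain

variable {Ω : Type*} {c α k : ℝ} {φ : ℝ → ℝ} {X₀ Y₀ : Ω → ℝ} {t Z : ℕ → Ω → ℝ}

theorem shockCount_time {ω : Ω} (ht : StrictMono fun n => t n ω) (n : ℕ) :
    shockCount t (t n ω) ω = n := by
  have : {i : ℕ | 1 ≤ i ∧ t i ω ≤ t n ω} = ↑(Finset.Icc 1 n) := by
    ext i
    simp [ht.le_iff_le]
  rw [shockCount, this, Set.ncard_coe_finset]
  simp

theorem stress_time {ω : Ω} (ht : StrictMono fun n => t n ω) (n : ℕ) :
    stress c X₀ t Z (t n ω) ω = X₀ ω + c * t n ω - ∑ i ∈ Finset.Icc 1 n, Z i ω := by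
  rw [stress, shockCount_time ht]

theorem aftershock_time {ω : Ω} (ht : StrictMono fun n => t n ω) (n : ℕ) :
    aftershock α k Y₀ t (t n ω) ω = Y₀ ω * Real.exp (-α * t n ω) +
      k * ∑ i ∈ Finset.Icc 1 n, Real.exp (-α * (t n ω - t i ω)) := by
  rw [aftershock, shockCount_time ht]

theorem aftershock_nonneg (hk : 0 ≤ k) {ω : Ω} (hY : 0 ≤ Y₀ ω) (s : ℝ) :
    0 ≤ aftershock α k Y₀ t s ω := by
  unfold aftershock
  have := Finset.sum_nonneg (s := Finset.Icc 1 (shockCount t s ω))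
    fun i _ => (Real.exp_pos (-α * (s - t i ω))).le
  positivity

theorem embedded_succ (hk : 0 ≤ k) {ω : Ω} (hY : 0 ≤ Y₀ ω) (ht : StrictMono fun n => t n ω)
    (n : ℕ) : embedded c α k X₀ Y₀ t Z (n + 1) ω =
      nextState c α k (embedded c α k X₀ Y₀ t Z n ω) (t (n + 1) ω - t n ω) (Z (n + 1) ω) := by
  have h0 := aftershock_nonneg (α := α) (t := t) hk hY (t n ω)
  rw [embedded, nextState, embedded, Real.coe_toNNReal _ h0, stress_time ht, stress_time ht,
    aftershock_time ht, aftershock_time ht, Finset.sum_Icc_succ_top (by omega),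
    Finset.sum_Icc_succ_top (by omega)]
  refine Prod.ext ?_ (congrArg Real.toNNReal ?_)
  · simp only
    ring
  · have e : ∀ s, Real.exp (-α * (t (n + 1) ω - s)) =
        Real.exp (-α * (t n ω - s)) * Real.exp (-α * (t (n + 1) ω - t n ω)) := fun s => by
      rw [← Real.exp_add]; ring_nf
    have e0 := e 0
    simp only [sub_zero] at e0
    rw [Finset.sum_congr rfl fun i _ => e (t i ω), ← Finset.sum_mul, e0, sub_self, mul_zero,
      Real.exp_zero]
    ring

theorem measurable_history_initial (X₀ Y₀ : Ω → ℝ) (t Z : ℕ → Ω → ℝ) (n : ℕ) :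
    Measurable[history X₀ Y₀ t Z n] X₀ ∧ Measurable[history X₀ Y₀ t Z n] Y₀ :=
  ⟨measurable_iff_comap_le.2 (le_sup_left.trans le_sup_left),
    measurable_iff_comap_le.2 (le_sup_right.trans le_sup_left)⟩

theorem measurable_history {i n : ℕ} (hi : i ∈ Finset.Icc 1 n) :
    Measurable[history X₀ Y₀ t Z n] (t i) ∧ Measurable[history X₀ Y₀ t Z n] (Z i) := by
  have h : MeasurableSpace.comap (t i) inferInstance ⊔ MeasurableSpace.comap (Z i) inferInstance ≤
      history X₀ Y₀ t Z n :=
    (le_iSup₂ (f := fun i (_ : i ∈ Finset.Icc 1 n) => MeasurableSpace.comap (t i) inferInstance ⊔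
      MeasurableSpace.comap (Z i) inferInstance) i hi).trans le_sup_right
  exact ⟨measurable_iff_comap_le.2 (le_sup_left.trans h),
    measurable_iff_comap_le.2 (le_sup_right.trans h)⟩

theorem measurable_history_time (h0 : ∀ ω, t 0 ω = 0) (n : ℕ) :
    Measurable[history X₀ Y₀ t Z n] (t n) := by
  rcases Nat.eq_zero_or_pos n with rfl | hn
  · rw [show t 0 = fun _ => 0 from funext h0]
    exact measurable_const
  · exact (measurable_history (Finset.mem_Icc.2 ⟨hn, le_rfl⟩)).1

theorem measurable_embedded (h0 : ∀ ω, t 0 ω = 0) (ht : ∀ ω, StrictMono fun n => t n ω) (n : ℕ) :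
    Measurable[history X₀ Y₀ t Z n] (embedded c α k X₀ Y₀ t Z n) := by
  obtain ⟨hX, hY⟩ := measurable_history_initial X₀ Y₀ t Z n
  have htn := measurable_history_time (X₀ := X₀) (Y₀ := Y₀) (Z := Z) h0 n
  have e : embedded c α k X₀ Y₀ t Z n = fun ω =>
      (X₀ ω + c * t n ω - ∑ i ∈ Finset.Icc 1 n, Z i ω, (Y₀ ω * Real.exp (-α * t n ω) +
        k * ∑ i ∈ Finset.Icc 1 n, Real.exp (-α * (t n ω - t i ω))).toNNReal) := by
    funext ω
    rw [embedded, stress_time (ht ω), aftershock_time (ht ω)]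
  rw [e]
  have h1 : Measurable[history X₀ Y₀ t Z n] fun ω => ∑ i ∈ Finset.Icc 1 n, Z i ω :=
    Finset.measurable_fun_sum _ fun i hi => (measurable_history hi).2
  have h2 : Measurable[history X₀ Y₀ t Z n] fun ω =>
      ∑ i ∈ Finset.Icc 1 n, Real.exp (-α * (t n ω - t i ω)) :=
    Finset.measurable_fun_sum _ fun i hi =>
      ((htn.sub (measurable_history hi).1).const_mul (-α)).exp
  exact ((hX.add (htn.const_mul c)).sub h1).prodMk
    ((hY.mul (htn.const_mul (-α)).exp).add (h2.const_mul k)).real_toNNReal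

/-- The law of the waiting time as a kernel. -/
noncomputable def waitingKernel (c α : ℝ) {φ : ℝ → ℝ} (hφ : IsPrimaryRate φ) :
    Kernel (ℝ × ℝ≥0) ℝ where
  toFun w := waitingLaw c α φ w.1 w.2
  measurable' := measurable_waitingLaw hφ

theorem isMarkovKernel_waitingKernel (hc : 0 < c) (hφ : IsPrimaryRate φ) :
    IsMarkovKernel (waitingKernel c α hφ) :=
  ⟨fun w => isProbabilityMeasure_waitingLaw hc hφ w.1 w.2.coe_nonneg⟩

variable [mΩ : MeasurableSpace Ω] {P : Measure Ω} {ν : Measure ℝ}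

namespace IsShockProcess

theorem history_le (h : IsShockProcess P c α k φ ν X₀ Y₀ t Z) (n : ℕ) :
    history X₀ Y₀ t Z n ≤ mΩ :=
  sup_le (sup_le h.measurable_X₀.comap_le h.measurable_Y₀.comap_le)
    (iSup₂_le fun i _ => sup_le (h.measurable_time i).comap_le (h.measurable_mark i).comap_le)

variable [IsProbabilityMeasure P]

/-- The conditional law of the waiting time given the history is `waitingLaw`: test on events `A` of
the history. -/
theorem map_waitingTime (h : IsShockProcess P c α k φ ν X₀ Y₀ t Z) (hc : 0 < c) (hk : 0 ≤ k)
    (hφ : IsPrimaryRate φ) (n : ℕ) {A : Set Ω} (hA : MeasurableSet[history X₀ Y₀ t Z n] A) :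
    (P.restrict A).map (fun ω => t (n + 1) ω - t n ω) =
      ((P.restrict A).map (embedded c α k X₀ Y₀ t Z n)).bind (waitingKernel c α hφ) := by
  have := isMarkovKernel_waitingKernel (α := α) hc hφ
  have hm := h.history_le n
  have hV := (measurable_embedded (c := c) (α := α) (k := k) (X₀ := X₀) (Y₀ := Y₀) (Z := Z)
    h.time_zero h.strictMono_time n).mono hm le_rfl
  have hT : Measurable fun ω => t (n + 1) ω - t n ω :=
    (h.measurable_time _).sub (h.measurable_time _)
  have hu : ((P.restrict A).map (fun ω => t (n + 1) ω - t n ω)) Set.univ =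
      (((P.restrict A).map (embedded c α k X₀ Y₀ t Z n)).bind (waitingKernel c α hφ))
        Set.univ := by
    rw [Measure.bind_apply .univ (Kernel.aemeasurable _), Measure.map_apply hT .univ]
    simp [Measure.map_apply hV .univ]
  have : IsFiniteMeasure ((P.restrict A).map (fun ω => t (n + 1) ω - t n ω)) := inferInstance
  refine ext_of_generate_finite (Set.range Set.Ioi) (borel_eq_generateFrom_Ioi ℝ ▸
    BorelSpace.measurable_eq) isPiSystem_Ioi ?_ hu
  rintro _ ⟨s, rfl⟩
  rw [Measure.bind_apply measurableSet_Ioi (Kernel.aemeasurable _),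
    Measure.map_apply hT measurableSet_Ioi,
    lintegral_map (Kernel.measurable_coe _ measurableSet_Ioi) hV]
  -- for negative `s` the hazard rate says nothing, but the waiting time is positive
  rcases lt_or_ge s 0 with hs | hs
  · have h1 : (fun ω => t (n + 1) ω - t n ω) ⁻¹' Set.Ioi s = Set.univ := by
      refine Set.eq_univ_of_forall fun ω => ?_
      have : t n ω < t (n + 1) ω := h.strictMono_time ω (Nat.lt_succ_self n)
      change s < t (n + 1) ω - t n ω
      linarith
    have h2 : ∀ w, waitingKernel c α hφ w (Set.Ioi s) = 1 := fun w => by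
      refine (prob_compl_eq_zero_iff measurableSet_Ioi).1 (measure_mono_null ?_
        (waitingLaw_Iic w.1 w.2))
      intro r hr
      have : ¬ s < r := hr
      exact (not_lt.1 this).trans hs.le
    rw [h1]
    simp [h2]
  · have hms : MeasurableSet {ω | s < t (n + 1) ω - t n ω} := measurableSet_lt measurable_const hT
    have h1 : ∀ ω, waitingKernel c α hφ (embedded c α k X₀ Y₀ t Z n ω) (Set.Ioi s) =
        ENNReal.ofReal (survival c α φ (stress c X₀ t Z (t n ω) ω)
          (aftershock α k Y₀ t (t n ω) ω) s) := fun ω => by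
      refine (waitingLaw_Ioi hc hφ _ (NNReal.coe_nonneg _) hs).trans ?_
      rw [embedded, Real.coe_toNNReal _ (aftershock_nonneg hk (h.Y₀_nonneg ω) _)]
    have h2 := h.conditional_hazard n s hs
    have hint : Integrable (fun ω => survival c α φ (stress c X₀ t Z (t n ω) ω)
        (aftershock α k Y₀ t (t n ω) ω) s) P := integrable_condExp.congr h2
    simp_rw [h1]
    rw [← ofReal_integral_eq_lintegral_ofReal hint.restrict
      (Eventually.of_forall fun ω => survival_nonneg _ _ _),
      ← setIntegral_congr_ae (hm _ hA) (h2.mono fun ω hω _ => hω),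
      setIntegral_condExp hm ((integrable_const 1).indicator hms) hA,
      integral_indicator_const _ hms, smul_eq_mul, mul_one, ofReal_measureReal]
    rfl

/-- The joint law of the state, the next waiting time and the next release, on an event `A` of the
history. -/
theorem map_transition [IsProbabilityMeasure ν] (h : IsShockProcess P c α k φ ν X₀ Y₀ t Z)
    (hc : 0 < c) (hk : 0 ≤ k) (hφ : IsPrimaryRate φ) (n : ℕ) {A : Set Ω}
    (hA : MeasurableSet[history X₀ Y₀ t Z n] A) :
    (P.restrict A).map (fun ω => (embedded c α k X₀ Y₀ t Z n ω, t (n + 1) ω - t n ω,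
        Z (n + 1) ω)) =
      ((P.restrict A).map (embedded c α k X₀ Y₀ t Z n)) ⊗ₘ
        (waitingKernel c α hφ ×ₖ Kernel.const _ ν) := by
  have := isMarkovKernel_waitingKernel (α := α) hc hφ
  have hm := h.history_le n
  have hVm := measurable_embedded (c := c) (α := α) (k := k) (X₀ := X₀) (Y₀ := Y₀) (Z := Z)
    h.time_zero h.strictMono_time n
  have hV := hVm.mono hm le_rfl
  have hT : Measurable fun ω => t (n + 1) ω - t n ω :=
    (h.measurable_time _).sub (h.measurable_time _)
  have hZ := h.measurable_mark (n + 1)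
  refine Measure.ext_prod₃ fun {D E F} hD hE hF => ?_
  have hA' : MeasurableSet[history X₀ Y₀ t Z n] (embedded c α k X₀ Y₀ t Z n ⁻¹' D ∩ A) :=
    (hVm hD).inter hA
  have hTm : Measurable[history X₀ Y₀ t Z n ⊔ MeasurableSpace.comap (t (n + 1)) inferInstance]
      fun ω => t (n + 1) ω - t n ω :=
    (measurable_iff_comap_le.2 le_sup_right).sub
      ((measurable_history_time h.time_zero n).mono le_sup_left le_rfl)
  have hind := (Indep_iff _ _ P).1 (h.mark_indep n) (Z (n + 1) ⁻¹' F)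
    ((embedded c α k X₀ Y₀ t Z n ⁻¹' D ∩ A) ∩ (fun ω => t (n + 1) ω - t n ω) ⁻¹' E)
    ⟨F, hF, rfl⟩ (((le_sup_left : history X₀ Y₀ t Z n ≤ history X₀ Y₀ t Z n ⊔
      MeasurableSpace.comap (t (n + 1)) inferInstance) _ hA').inter (hTm hE))
  have hlaw : P (Z (n + 1) ⁻¹' F) = ν F := by rw [← h.mark_law n, Measure.map_apply hZ hF]
  have hwait := congrArg (fun μ : Measure ℝ => μ E) (h.map_waitingTime hc hk hφ n hA')
  rw [Measure.map_apply hT hE, Measure.restrict_apply (hT hE),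
    Measure.bind_apply hE (Kernel.aemeasurable _),
    lintegral_map (Kernel.measurable_coe _ hE) hV] at hwait
  rw [Measure.map_apply (hV.prodMk (hT.prodMk hZ)) (hD.prod (hE.prod hF)),
    Measure.restrict_apply ((hV.prodMk (hT.prodMk hZ)) (hD.prod (hE.prod hF))),
    Measure.compProd_apply_prod hD (hE.prod hF), Measure.restrict_map hV hD,
    lintegral_map (Kernel.measurable_coe _ (hE.prod hF)) hV,
    Measure.restrict_restrict (hV hD)]
  have hset : (fun ω => (embedded c α k X₀ Y₀ t Z n ω, t (n + 1) ω - t n ω, Z (n + 1) ω)) ⁻¹'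
      D ×ˢ E ×ˢ F ∩ A = Z (n + 1) ⁻¹' F ∩ ((embedded c α k X₀ Y₀ t Z n ⁻¹' D ∩ A) ∩
        (fun ω => t (n + 1) ω - t n ω) ⁻¹' E) := by
    ext ω
    simp only [Set.mem_inter_iff, Set.mem_preimage, Set.mem_prod]
    tauto
  rw [hset, hind, hlaw, Set.inter_comm, hwait]
  simp_rw [Kernel.prod_apply, Measure.prod_prod, Kernel.const_apply]
  rw [lintegral_mul_const' _ _ (measure_ne_top _ _), mul_comm]

theorem isMarkovChain [IsProbabilityMeasure ν] (h : IsShockProcess P c α k φ ν X₀ Y₀ t Z)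
    (hc : 0 < c) (hk : 0 ≤ k) (hφ : IsPrimaryRate φ) :
    IsMarkovChain P (history X₀ Y₀ t Z) (embedded c α k X₀ Y₀ t Z)
      (embeddedKernel c α k hφ ν) where
  adapted := measurable_embedded h.time_zero h.strictMono_time
  transition n B hB := by
    have := isMarkovKernel_waitingKernel (α := α) hc hφ
    have := isMarkovKernel_embeddedKernel (α := α) (k := k) hc hφ ν
    have hm := h.history_le n
    have hVm := measurable_embedded (c := c) (α := α) (k := k) (X₀ := X₀) (Y₀ := Y₀) (Z := Z)
      h.time_zero h.strictMono_time n
    have hV := hVm.mono hm le_rfl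
    have hV1 := (measurable_embedded (c := c) (α := α) (k := k) (X₀ := X₀) (Y₀ := Y₀) (Z := Z)
      h.time_zero h.strictMono_time (n + 1)).mono (h.history_le _) le_rfl
    have hT : Measurable fun ω => t (n + 1) ω - t n ω :=
      (h.measurable_time _).sub (h.measurable_time _)
    have hκ := measurable_kernel_real (embeddedKernel c α k hφ ν) hB
    have hκi : Integrable (fun ω => (embeddedKernel c α k hφ ν
        (embedded c α k X₀ Y₀ t Z n ω)).real B) P :=
      Integrable.of_bound (hκ.comp hV).aestronglyMeasurable 1 (Eventually.of_forall fun ω => by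
        rw [Real.norm_of_nonneg measureReal_nonneg]; exact measureReal_le_one)
    refine (ae_eq_condExp_of_forall_setIntegral_eq hm ((integrable_const 1).indicator (hV1 hB))
      (fun _ _ _ => hκi.integrableOn) (fun A hA _ => ?_)
      (hκ.comp hVm).stronglyMeasurable.aestronglyMeasurable).symm
    rw [integral_indicator_const _ (hV1 hB), smul_eq_mul, mul_one]
    let G : Set ((ℝ × ℝ≥0) × ℝ × ℝ) := (fun q => nextState c α k q.1 q.2.1 q.2.2) ⁻¹' B
    have hG : MeasurableSet G := measurable_nextState c α k hB
    have h1 := congrArg (fun μ : Measure ((ℝ × ℝ≥0) × ℝ × ℝ) => μ.real G)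
      (h.map_transition hc hk hφ n hA)
    have h2 : (fun ω => (embedded c α k X₀ Y₀ t Z n ω, t (n + 1) ω - t n ω, Z (n + 1) ω)) ⁻¹' G =
        embedded c α k X₀ Y₀ t Z (n + 1) ⁻¹' B := by
      ext ω
      simp only [G, Set.mem_preimage, embedded_succ hk (h.Y₀_nonneg ω) (h.strictMono_time ω)]
    have h3 : ∀ w, (waitingKernel c α hφ ×ₖ Kernel.const _ ν) w (Prod.mk w ⁻¹' G) =
        embeddedKernel c α k hφ ν w B := fun w => by
      rw [embeddedKernel_apply, Measure.map_apply (measurable_nextState_apply c α k w) hB,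
        Kernel.prod_apply, Kernel.const_apply]
      rfl
    rw [map_measureReal_apply (hV.prodMk (hT.prodMk (h.measurable_mark _))) hG, h2,
      measureReal_def (Measure.compProd _ _), Measure.compProd_apply hG] at h1
    simp_rw [h3] at h1
    rw [lintegral_map (Kernel.measurable_coe _ hB) hV] at h1
    rw [h1]
    exact integral_toReal ((Kernel.measurable_coe _ hB).comp hV).aemeasurable
      (Eventually.of_forall fun ω => measure_lt_top _ _)

end IsShockProcess
end Chain

theorem theorem2 {c α k : ℝ} (hc : 0 < c) (hk : 0 < k) (hkα : k < α)
    {φ : ℝ → ℝ} (hφ : IsPrimaryRate φ)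
    (ν : Measure ℝ) [IsProbabilityMeasure ν] (hν_nonneg : ∀ᵐ z ∂ν, 0 ≤ z)
    (hν_mean : Integrable (fun z : ℝ => z) ν) (hCZ : ConditionCZ ν) :
    IsMarkovKernel (embeddedKernel c α k hφ ν) ∧
    (∀ {Ω : Type*} [MeasurableSpace Ω] (P : Measure Ω) [IsProbabilityMeasure P]
      (X₀ Y₀ : Ω → ℝ) (t Z : ℕ → Ω → ℝ), IsShockProcess P c α k φ ν X₀ Y₀ t Z →
      IsMarkovChain P (history X₀ Y₀ t Z) (embedded c α k X₀ Y₀ t Z)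
        (embeddedKernel c α k hφ ν)) ∧
    IsHarrisErgodic (embeddedKernel c α k hφ ν) :=
  ⟨isMarkovKernel_embeddedKernel hc hφ ν,
    fun _ _ _ _ _ _ h => h.isMarkovChain hc hk.le hφ,
    isHarrisErgodic_embeddedKernel ν hc hk hkα hφ hν_nonneg hν_mean hCZ⟩
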